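/- **Setting.** An observed cluster is $O=(Y,A,X,N)$, where $N$ is the cluster size, $Y\in\mathbb R^N$, $A\in\mathcal A(N)=\{0,1\}^N$ and $X=(X_1,\dots,X_N)$ with $X_j\in\mathbb R^p$; its law is $\mathbb P$. Put $G(a,x,n)=\mathbb E(Y\mid A=a,X=x,N=n)$ and $H(a,x,n)=\mathbb P(A=a\mid X=x,N=n)$. Let $w(a,x,n)\in\mathbb R^n$ be a weight function, which may be a functional of $\mathbb P$, and suppose that, for fixed $(a,x,n)$, its efficient influence function in the nonparametric model is $\{\mathbf 1(X=x,N=n)/d\mathbb P(x,n)\}\,\phi(A,X,N;a)$. Precisely: $\sum_{a'}\phi(a',X,N;a)H(a',X,N)=0$ almost surely for every $a$, and for every bounded measurable score $s$ with $\mathbb E\,s(O)=0$ and every bounded measurable $g(a,x,n)\in\mathbb R^n$, along $d\mathbb P_\varepsilon=(1+\varepsilon s)\,d\mathbb P$ the integral $\mathbb E\sum_a g(a,X,N)^\top w(a,X,N;\mathbb P_\varepsilon)$ exists for $\varepsilon$ near $0$ and has derivative $\mathbb E[s(O)\sum_a g(a,X,N)^\top\phi(A,X,N;a)]$ at $\varepsilon=0$.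 Write $\eta=(G,H,w,\phi)$ and $$\Psi(w)=\mathbb E\Big\{\sum_{a\in\mathcal A(N)}w(a,X,N)^\top G(a,X,N)\Big\},\qquad h(O,a)=\{w(a,X,N)+\phi(A,X,N;a)\}^\top G(a,X,N),$$ $$l(O)=\frac{w(A,X,N)^\top\{Y-G(A,X,N)\}}{H(A,X,N)},\qquad \varphi(O;\eta)=\sum_{a\in\mathcal A(N)}h(O,a)+l(O),\qquad \sigma^2(w)=\mathbb E[\{\varphi(O;\eta)-\Psi(w)\}^2].$$ **Estimator.** For each $n$ let $f$ be a probability distribution on $\mathcal A(n)$ with $f(a)>0$ for all $a$, and fix $r\ge1$ and $K\ge1$. One observes i.i.d. copies $Z_i=(O_i,a_i^{(1)},\dots,a_i^{(r)})$, $i=1,\dots,m$, where $O_i\sim\mathbb P$ and, given $O_i$, the $a_i^{(q)}$ are i.i.d. draws from $f$ on $\mathcal A(N_i)$. Let $$\varphi(Z;\eta)=\frac1r\sum_{q=1}^r\frac{h(O,a^{(q)})}{f(a^{(q)})}+l(O).$$ The clusters are partitioned at random, independently of the $Z_i$, into groups $1,\dots,K$ of sizes $m_k$ with $m_k/m=1/K+O(1/m)$.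 For each $k$ let $\widehat\eta^{(-k)}=(\widehat G^{(-k)},\widehat H^{(-k)},\widehat w^{(-k)},\widehat\phi^{(-k)})$ be a (jointly measurable) estimator of $\eta$ computed from the clusters $O_i$ outside group $k$, from the partition and possibly from auxiliary randomness independent of the $Z_i$. Set $$\widehat\Psi^{\mathrm{app}}(w)=\frac1K\sum_{k=1}^K\frac1{m_k}\sum_{i\text{ in group }k}\varphi(Z_i;\widehat\eta^{(-k)}).$$ **Assumptions.** There are $c\in(0,1)$, $C\in(0,\infty)$ and $n_{\max}\in\mathbb N$ such that $N\le n_{\max}$ almost surely; $|\mathbb E(Y_j^q\mid A,X,N)|\le C$ for all units $j$ and $q=1,\dots,4$, with $Y_j^q$ integrable; and, for $\mathbb P$-almost all $(x,n)$, all $a,a'\in\mathcal A(n)$, all $m$ and $k$ (and almost surely for the estimators), $H(a,x,n)$ and $\widehat H^{(-k)}(a,x,n)$ lie in $(c,1-c)$, and $G(a,x,n)$, $\phi(a',x,n;a)$, $w(a,x,n)$ and their estimators $\widehat G^{(-k)},\widehat\phi^{(-k)},\widehat w^{(-k)}$ have Euclidean norm at most $C$. Moreover there are positive sequences $r_G,r_H,r_\phi,r_w$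 (indexed by $m$) such that for every $k$, with $\|g\|=\{\int g^2\,d\mathbb P\}^{1/2}$ computed for the estimated functions held fixed, $$\Big\|\sum_a|(\widehat H^{(-k)}-H)(a,X,N)|\Big\|=O_{\mathbb P}(r_H),\qquad \Big\|\sum_a\|(\widehat G^{(-k)}-G)(a,X,N)\|_2\Big\|=O_{\mathbb P}(r_G),$$ $$\Big\|\sum_a\|(\widehat\phi^{(-k)}-\phi)(A,X,N;a)\|_2\Big\|=O_{\mathbb P}(r_\phi),$$ $$\Big\|\sum_a\Big\|(\widehat w^{(-k)}-w)(a,X,N)+\sum_{a'}\widehat\phi^{(-k)}(a',X,N;a)H(a',X,N)\Big\|_2\Big\|=O_{\mathbb P}(r_w^2).$$ Finally, as $m\to\infty$: (i) $r_G$, $r_H$ and $r_\phi$ are $o(1)$; (ii) $r_w=o(m^{-1/4})$; (iii) $r_G(r_H+r_\phi)=o(m^{-1/2})$. **Theorem.** Under these assumptions, for fixed $r$ and $K$ and as $m\to\infty$, $$\sqrt m\,\{\widehat\Psi^{\mathrm{app}}(w)-\Psi(w)\}\overset{d}{\to}N(0,\sigma^2_{\mathrm{app}}(w)),$$ where $$\sigma^2_{\mathrm{app}}(w)=\mathrm{Var}\{\varphi(Z;\eta)\}=\sigma^2(w)+\frac1r\,\mathbb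 E\Big[\mathrm{Var}\Big\{\frac{h(O,a)}{f(a)}\,\Big|\,O\Big\}\Big],$$ and $a$ in the last term is, given $O$, a draw from $f$ on $\mathcal A(N)$. -/

import Mathlib

open MeasureTheory ProbabilityTheory Filter Topology Asymptotics

noncomputable section

namespace ClusterSubsampling

/-! ### Observed clusters -/

/-- Outcomes, binary treatments and covariates in `ℝ^p` of the `n` units of a cluster of size `n`. -/
abbrev ClusterData (p n : ℕ) : Type :=
  EuclideanSpace ℝ (Fin n) × (Fin n → Bool) × (Fin n → Fin p → ℝ)

/-- An observed cluster `O = (Y, A, X, N)`, where the size `N` is the first component. -/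
abbrev Obs (p : ℕ) : Type := Σ n : ℕ, ClusterData p n

/-- A treatment vector together with its length. -/
abbrev TreatVec : Type := Σ n : ℕ, (Fin n → Bool)

/-- The pair `(X, N)`. -/
abbrev Cov (p : ℕ) : Type := Σ n : ℕ, (Fin n → Fin p → ℝ)

/-- The triple `(A, X, N)`. -/
abbrev TreatCov (p : ℕ) : Type := Σ n : ℕ, (Fin n → Bool) × (Fin n → Fin p → ℝ)

instance instDiscreteTreatVec : DiscreteMeasurableSpace TreatVec := by
  refine ⟨fun s => ?_⟩
  refine MeasurableSpace.measurableSet_iInf.2 fun n => ?_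
  exact MeasurableSet.of_discrete (s := Sigma.mk n ⁻¹' s)

variable {p : ℕ}

def outcome (o : Obs p) : EuclideanSpace ℝ (Fin o.1) := o.2.1

def treat (o : Obs p) : Fin o.1 → Bool := o.2.2.1

def covar (o : Obs p) : Fin o.1 → Fin p → ℝ := o.2.2.2

def treatVec (o : Obs p) : TreatVec := ⟨o.1, treat o⟩

def cov (o : Obs p) : Cov p := ⟨o.1, covar o⟩

def treatCov (o : Obs p) : TreatCov p := ⟨o.1, treat o, covar o⟩

/-- The outcome of the unit with index `j`; it is `0` if the cluster has no such unit. -/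
def unitOutcome (j : ℕ) (o : Obs p) : ℝ := if h : j < o.1 then outcome o ⟨j, h⟩ else 0

/-! ### Nuisance functions -/

/-- Vector-valued functions of `(a, x, n)`, with arguments in the order `n, a, x`. -/
abbrev VecFun (p : ℕ) : Type :=
  ∀ n : ℕ, (Fin n → Bool) → (Fin n → Fin p → ℝ) → EuclideanSpace ℝ (Fin n)

/-- Vector-valued functions `φ(a', x, n; a)`, with arguments in the order `n, a', x, a`. -/
abbrev InflFun (p : ℕ) : Type :=
  ∀ n : ℕ, (Fin n → Bool) → (Fin n → Fin p → ℝ) → (Fin n → Bool) → EuclideanSpace ℝ (Fin n)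

/-- A quadruple `η = (G, H, w, φ)`. -/
structure Nuisance (p : ℕ) where
  G : VecFun p
  H : ∀ n : ℕ, (Fin n → Bool) → (Fin n → Fin p → ℝ) → ℝ
  w : VecFun p
  phi : InflFun p

/-- The outcome regression `G(a, x, n) = E(Y | A = a, X = x, N = n)` under the law `P`. -/
def outcomeRegression (P : Measure (Obs p)) [IsFiniteMeasure P] : VecFun p := fun n a x =>
  WithLp.toLp 2 fun j : Fin n =>
    ∫ y, y ∂(condDistrib (unitOutcome (j : ℕ)) treatCov P ⟨n, a, x⟩)

/-- The treatment probability `H(a, x, n) = P(A = a | X = x, N = n)` under the law `P`. -/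
def treatmentProb (P : Measure (Obs p)) [IsFiniteMeasure P] (n : ℕ) (a : Fin n → Bool)
    (x : Fin n → Fin p → ℝ) : ℝ :=
  (condDistrib treatVec cov P ⟨n, x⟩).real {(⟨n, a⟩ : TreatVec)}

/-- The submodel `dP_ε = (1 + ε s) dP` through `P` with score `s`. -/
def submodel (P : Measure (Obs p)) (s : Obs p → ℝ) (ε : ℝ) : Measure (Obs p) :=
  P.withDensity fun o => ENNReal.ofReal (1 + ε * s o)

/-- `{1(X = x, N = n) / dP(x, n)} φ(A, X, N; a)` is, at `P`, the efficient influence function of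
the weight `w(a, x, n) = W(P)(a, x, n)`, in the nonparametric model. The factor
`1(X = x, N = n) / dP(x, n)` is a density (a point mass when `(X, N)` is discrete), so
the equations are understood after integration against test functions of `(a, x, n)`: the
influence function is centered, and its inner product with each bounded score is the pathwise
derivative of `W` along the corresponding submodel. -/
structure IsWeightEIF (P : Measure (Obs p)) [IsFiniteMeasure P] (W : Measure (Obs p) → VecFun p)
    (phi : InflFun p) : Prop where
  centered : ∀ᵐ o ∂P, ∀ a : Fin o.1 → Bool,
    ∑ a' : Fin o.1 → Bool, treatmentProb P o.1 a' (covar o) • phi o.1 a' (covar o) a = 0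
  pathwise : ∀ s : Obs p → ℝ, Measurable s → (∃ B : ℝ, ∀ o, |s o| ≤ B) → ∫ o, s o ∂P = 0 →
    ∀ g : VecFun p, (∀ n a, Measurable (g n a)) → (∃ B : ℝ, ∀ n a x, ‖g n a x‖ ≤ B) →
      (∀ᶠ ε in 𝓝 (0 : ℝ), Integrable (fun o => ∑ a : Fin o.1 → Bool,
        inner ℝ (g o.1 a (covar o)) (W (submodel P s ε) o.1 a (covar o))) P) ∧
      HasDerivAt
        (fun ε : ℝ => ∫ o, ∑ a : Fin o.1 → Bool,
          inner ℝ (g o.1 a (covar o)) (W (submodel P s ε) o.1 a (covar o)) ∂P)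
        (∫ o, (∑ a : Fin o.1 → Bool,
          inner ℝ (g o.1 a (covar o)) (phi o.1 (treat o) (covar o) a)) * s o ∂P) 0

/-- The true nuisance functions under `P`. -/
def trueNuisance (P : Measure (Obs p)) [IsFiniteMeasure P] (W : Measure (Obs p) → VecFun p)
    (phi : InflFun p) : Nuisance p where
  G := outcomeRegression P
  H := treatmentProb P
  w := W P
  phi := phi

/-! ### Estimand and influence function -/

/-- `Ψ(w) = E{∑_a w(a, X, N)ᵀ E(Y | A = a, X, N)}`. -/
def estimand (P : Measure (Obs p)) [IsFiniteMeasure P] (w : VecFun p) : ℝ :=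
  ∫ o, ∑ a : Fin o.1 → Bool,
    inner ℝ (w o.1 a (covar o)) (outcomeRegression P o.1 a (covar o)) ∂P

/-- `h(O, a) = {w(a, X, N) + φ(A, X, N; a)}ᵀ G(a, X, N)`. -/
def hTerm (η : Nuisance p) (o : Obs p) (a : Fin o.1 → Bool) : ℝ :=
  inner ℝ (η.w o.1 a (covar o) + η.phi o.1 (treat o) (covar o) a) (η.G o.1 a (covar o))

/-- `l(O) = w(A, X, N)ᵀ {Y - G(A, X, N)} / H(A, X, N)`. -/
def lTerm (η : Nuisance p) (o : Obs p) : ℝ :=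
  inner ℝ (η.w o.1 (treat o) (covar o)) (outcome o - η.G o.1 (treat o) (covar o)) /
    η.H o.1 (treat o) (covar o)

/-- The uncentered influence function `φ(O; η) = ∑_a h(O, a) + l(O)`. -/
def uncenteredIF (η : Nuisance p) (o : Obs p) : ℝ :=
  (∑ a : Fin o.1 → Bool, hTerm η o a) + lTerm η o

/-- `σ²(w) = E[{φ(O; η) - Ψ(w)}²]` at the true nuisance functions. -/
def sigmaSq (P : Measure (Obs p)) [IsFiniteMeasure P] (W : Measure (Obs p) → VecFun p)
    (phi : InflFun p) : ℝ :=
  ∫ o, (uncenteredIF (trueNuisance P W phi) o - estimand P (W P)) ^ 2 ∂P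

/-! ### Subsampling -/

/-- `Z = (O, a^*)`: an observed cluster together with `r` treatment vectors of length `N`. -/
abbrev AugObs (p r : ℕ) : Type := Σ n : ℕ, ClusterData p n × (Fin r → Fin n → Bool)

variable {r : ℕ}

def AugObs.obs (z : AugObs p r) : Obs p := ⟨z.1, z.2.1⟩

def AugObs.draw (z : AugObs p r) (q : Fin r) : Fin z.1 → Bool := z.2.2 q

/-- The law of `Z = (O, a^*)` when `O` has law `P` and, given `O`, the `r` treatment vectors in
`a^*` are independent draws from the distribution `f N` on binary vectors of length `N`. -/
def augLaw (P : Measure (Obs p)) (f : ∀ n : ℕ, PMF (Fin n → Bool)) (r : ℕ) :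
    Measure (AugObs p r) :=
  Measure.sum fun n : ℕ =>
    ((P.comap (Sigma.mk n)).prod (Measure.pi fun _ : Fin r => (f n).toMeasure)).map (Sigma.mk n)

/-- The approximated influence function
`φ(Z; η) = r⁻¹ ∑_q h(O, a^(q)) / f(a^(q)) + l(O)`. -/
def approxIF (f : ∀ n : ℕ, PMF (Fin n → Bool)) (η : Nuisance p) (z : AugObs p r) : ℝ :=
  (1 / (r : ℝ)) * ∑ q : Fin r, hTerm η z.obs (z.draw q) / (f z.1 (z.draw q)).toReal
    + lTerm η z.obs

/-- `E[Var{h(O, a) / f(a) | O}]`, where `a` has distribution `f N` given `O`. -/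
def meanCondVar (P : Measure (Obs p)) (f : ∀ n : ℕ, PMF (Fin n → Bool)) (η : Nuisance p) : ℝ :=
  ∫ o, variance (fun a : Fin o.1 → Bool => hTerm η o a / (f o.1 a).toReal)
    (f o.1).toMeasure ∂P

/-! ### The sample-splitting estimator -/

/-- A nuisance estimation procedure. For sample size `m`, group `k` and group memberships `s`
it turns a value of the auxiliary randomness (in `Ξ`) and the data of the clusters outside
group `k` into an estimate of `η`. -/
abbrev Learner (p K : ℕ) (Ξ : Type*) :=
  ∀ (m : ℕ) (k : Fin K) (s : Fin m → Fin K), Ξ × ({i : Fin m // s i ≠ k} → Obs p) → Nuisance p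

/-- Joint measurability of the estimated nuisance functions. -/
structure Learner.IsMeasurable {K : ℕ} {Ξ : Type*} [MeasurableSpace Ξ] (L : Learner p K Ξ) :
    Prop where
  G : ∀ m k s n (a : Fin n → Bool), Measurable
    fun t : (Ξ × ({i : Fin m // s i ≠ k} → Obs p)) × (Fin n → Fin p → ℝ) =>
      (L m k s t.1).G n a t.2
  H : ∀ m k s n (a : Fin n → Bool), Measurable
    fun t : (Ξ × ({i : Fin m // s i ≠ k} → Obs p)) × (Fin n → Fin p → ℝ) =>
      (L m k s t.1).H n a t.2
  w : ∀ m k s n (a : Fin n → Bool), Measurable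
    fun t : (Ξ × ({i : Fin m // s i ≠ k} → Obs p)) × (Fin n → Fin p → ℝ) =>
      (L m k s t.1).w n a t.2
  phi : ∀ m k s n (a' a : Fin n → Bool), Measurable
    fun t : (Ξ × ({i : Fin m // s i ≠ k} → Obs p)) × (Fin n → Fin p → ℝ) =>
      (L m k s t.1).phi n a' t.2 a

/-- `m_k`, the size of group `k`. -/
def groupSize {K m : ℕ} (s : Fin m → Fin K) (k : Fin K) : ℕ :=
  (Finset.univ.filter fun i => s i = k).card

/-- The estimate of `η` trained on the clusters outside group `k`, when the auxiliary randomness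
is `ξ`, the group memberships are `s` and the observed data are `z 0, …, z (m - 1)`. -/
def trained {K m : ℕ} {Ξ : Type*} (L : Learner p K Ξ) (k : Fin K) (s : Fin m → Fin K) (ξ : Ξ)
    (z : ℕ → AugObs p r) : Nuisance p :=
  L m k s (ξ, fun i => (z i.1).obs)

/-- The estimator under the subsampling approximation,
`K⁻¹ ∑_k m_k⁻¹ ∑_{i in group k} φ(Z_i; η̂^(-k))`. -/
def appEstimator {K m : ℕ} {Ξ : Type*} (f : ∀ n : ℕ, PMF (Fin n → Bool)) (L : Learner p K Ξ)
    (s : Fin m → Fin K) (ξ : Ξ) (z : ℕ → AugObs p r) : ℝ :=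
  (1 / (K : ℝ)) * ∑ k : Fin K, (1 / (groupSize s k : ℝ)) *
    ∑ i ∈ Finset.univ.filter (fun i : Fin m => s i = k), approxIF f (trained L k s ξ z) (z i)

/-! ### Conditions -/

/-- The bounds on the nuisance functions at the covariates and size of the cluster `o`. -/
structure Nuisance.BoundedAt (c C : ℝ) (η : Nuisance p) (o : Obs p) : Prop where
  H : ∀ a, η.H o.1 a (covar o) ∈ Set.Ioo c (1 - c)
  G : ∀ a, ‖η.G o.1 a (covar o)‖ ≤ C
  phi : ∀ a' a, ‖η.phi o.1 a' (covar o) a‖ ≤ C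
  w : ∀ a, ‖η.w o.1 a (covar o)‖ ≤ C

/-- The `L₂(P)` norm `{∫ g² dP}^{1/2}`. -/
def l2norm (P : Measure (Obs p)) (g : Obs p → ℝ) : ℝ := Real.sqrt (∫ o, g o ^ 2 ∂P)

def errH (η' η : Nuisance p) (o : Obs p) : ℝ :=
  ∑ a : Fin o.1 → Bool, |η'.H o.1 a (covar o) - η.H o.1 a (covar o)|

def errG (η' η : Nuisance p) (o : Obs p) : ℝ :=
  ∑ a : Fin o.1 → Bool, ‖η'.G o.1 a (covar o) - η.G o.1 a (covar o)‖

def errPhi (η' η : Nuisance p) (o : Obs p) : ℝ :=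
  ∑ a : Fin o.1 → Bool,
    ‖η'.phi o.1 (treat o) (covar o) a - η.phi o.1 (treat o) (covar o) a‖

/-- The second order remainder
`∑_a ‖(ŵ - w)(a, X, N) + ∑_{a'} φ̂(a', X, N; a) H(a', X, N)‖`. -/
def errW (η' η : Nuisance p) (o : Obs p) : ℝ :=
  ∑ a : Fin o.1 → Bool,
    ‖η'.w o.1 a (covar o) - η.w o.1 a (covar o)
      + ∑ a' : Fin o.1 → Bool, η.H o.1 a' (covar o) • η'.phi o.1 a' (covar o) a‖

/-- `X_m = O_ℙ(ρ_m)` as `m → ∞`. -/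
def IsBigOP {Ω : Type*} [MeasurableSpace Ω] (μ : Measure Ω) (X : ℕ → Ω → ℝ) (ρ : ℕ → ℝ) : Prop :=
  ∀ δ : ℝ, 0 < δ → ∃ M : ℝ, ∀ᶠ m in atTop, μ.real {ω | M * ρ m < |X m ω|} ≤ δ

end ClusterSubsampling

end

open MeasureTheory ProbabilityTheory Filter Topology Asymptotics

noncomputable section

namespace ClusterSubsampling

/-! The estimator is asymptotically linear: `√m (Ψ̂ - Ψ)` differs from `m^{-1/2} ∑ᵢ {φ(Zᵢ; η) - Ψ}`
by `o_ℙ(1)` (`isLittleOP_remainder`). The summands at the true `η` are i.i.d., square integrable and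
have mean `Ψ`, so the central limit theorem and Slutsky's lemma give the limit.

The algebraic identity `sqrt_mul_weighted_sum_sub` splits the difference, group by group, into a
centered sum and `√m` times a bias. Given the partition, the auxiliary randomness and the clusters
outside a group, the fitted nuisance functions are fixed while the `Zᵢ` of the group are still
i.i.d. Chebyshev's inequality then controls the centered sum by the `L₂` distance between fitted and
true summands (`measure_fold_chebyshev`), without any entropy condition. This distance vanishes
because the summand is Lipschitz in the nuisance functions in `L₂` (`integral_sq_approxIF_sub_le`);
the unbounded outcome is absorbed by its conditional second moments.

Division by `f` makes each draw unbiased for `∑_a h(O, a)`, so the bias is that of the full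
influence function (`integral_approxIF`). Given `(X, N)`, with `S_a = ∑_{a'} φ̂(a', X, N; a) H(a',
X, N)`, it equals the sum over `a` of `(ŵ - w + S_a)ᵀĜ + Ĥ⁻¹(Ĥ - H) ŵᵀ(Ĝ - G) - (ŵ - w)ᵀ(Ĝ - G)`
(`abs_condBias_le`). The first term has order `r_w²` and the others are products of errors. Since
`φ` is centered, `ŵ - w` is bounded by the first remainder and the error of `φ̂` (`errWeight_le`).
The total is of order `r_w² + r_G (r_H + r_φ)`, which is `o(m^{-1/2})`.

The variance formula is the law of total variance given `O` (`variance_approxIF`): the conditional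
mean is `φ(O; η)`, and the average of `r` independent draws contributes `1/r` of the variance of one
draw. -/

variable {p r : ℕ}

/-! ### Measurability and measures on countable disjoint unions -/

section Sigma
variable {ι : Type*} {β : ι → Type*} [∀ i, MeasurableSpace (β i)]

theorem measurableSet_sigma_iff {s : Set (Sigma β)} :
    MeasurableSet s ↔ ∀ i, MeasurableSet (Sigma.mk i ⁻¹' s) :=
  MeasurableSpace.measurableSet_iInf

theorem measurable_sigma_mk (i : ι) : Measurable (Sigma.mk i : β i → Sigma β) :=
  fun _ hs => measurableSet_sigma_iff.1 hs i

theorem measurable_sigma_iff {γ : Type*} [MeasurableSpace γ] {g : Sigma β → γ} :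
    Measurable g ↔ ∀ i, Measurable fun b => g ⟨i, b⟩ :=
  ⟨fun h i => h.comp (measurable_sigma_mk i), fun h _ hs =>
    measurableSet_sigma_iff.2 fun i => h i hs⟩

theorem measurableEmbedding_sigma_mk (i : ι) :
    MeasurableEmbedding (Sigma.mk i : β i → Sigma β) where
  injective := sigma_mk_injective
  measurable := measurable_sigma_mk i
  measurableSet_image' := by
    intro s hs
    refine measurableSet_sigma_iff.2 fun j => ?_
    by_cases h : i = j
    · subst h
      rwa [Set.preimage_image_eq _ sigma_mk_injective]
    · convert! MeasurableSet.empty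
      ext b
      simp only [Set.mem_preimage, Set.mem_image, Set.mem_empty_iff_false, iff_false]
      rintro ⟨a, -, hab⟩
      exact h (congrArg Sigma.fst hab)

/-- The product is the countable union of the images of `α × β i` under measurable embeddings, so a
preimage can be assembled stratum by stratum. -/
theorem measurable_prod_sigma_iff [Countable ι] {α γ : Type*} [MeasurableSpace α]
    [MeasurableSpace γ] {g : α × Sigma β → γ} :
    Measurable g ↔ ∀ i, Measurable fun q : α × β i => g (q.1, ⟨i, q.2⟩) := by
  refine ⟨fun h i => h.comp (measurable_fst.prodMk
    ((measurable_sigma_mk i).comp measurable_snd)), fun h s hs => ?_⟩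
  have he : ∀ i, MeasurableEmbedding (Prod.map (id : α → α) (Sigma.mk i : β i → Sigma β)) :=
    fun i => MeasurableEmbedding.id.prodMap (measurableEmbedding_sigma_mk i)
  have : g ⁻¹' s = ⋃ i, Prod.map (id : α → α) (Sigma.mk i : β i → Sigma β) ''
      ((fun q : α × β i => g (q.1, ⟨i, q.2⟩)) ⁻¹' s) := by
    ext ⟨x, i, b⟩
    simp only [Set.mem_preimage, Set.mem_iUnion, Set.mem_image, Prod.exists]
    constructor
    · exact fun hx => ⟨i, x, b, hx, rfl⟩
    · rintro ⟨j, y, b', hy, hb⟩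
      simp only [Prod.map_apply, id, Prod.mk.injEq] at hb
      obtain ⟨rfl, hb⟩ := hb
      rwa [← hb]
  rw [this]
  exact MeasurableSet.iUnion fun i => (he i).measurableSet_image.2 (h i hs)

/-- Puts `P` in the form in which `augLaw` is defined, so that the two can be compared one cluster
size at a time. -/
theorem measure_eq_sum_map_comap_sigma_mk [Countable ι] (P : Measure (Sigma β)) :
    Measure.sum (fun i => (P.comap (Sigma.mk i)).map (Sigma.mk i)) = P := by
  ext s hs
  rw [Measure.sum_apply _ hs]
  have h1 : ∀ i, ((P.comap (Sigma.mk i)).map (Sigma.mk i)) s = P (s ∩ Set.range (Sigma.mk i)) := by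
    intro i
    rw [(measurableEmbedding_sigma_mk i).map_comap, Measure.restrict_apply hs]
  simp_rw [h1]
  rw [← measure_iUnion]
  · congr 1
    ext ⟨i, b⟩
    simp
  · intro i j hij
    refine Set.disjoint_left.2 ?_
    rintro _ ⟨-, b, rfl⟩ ⟨-, b', h⟩
    exact hij (congrArg Sigma.fst h).symm
  · exact fun i => hs.inter (measurableEmbedding_sigma_mk i).measurableSet_range

end Sigma

/-! ### Components of a cluster, and the law of a cluster with its draws -/

theorem measurable_treatCov : Measurable (treatCov : Obs p → TreatCov p) :=
  measurable_sigma_iff.2 fun n => (measurable_sigma_mk n).comp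
    (measurable_snd (α := EuclideanSpace ℝ (Fin n)) (β := (Fin n → Bool) × (Fin n → Fin p → ℝ)))

theorem measurable_cov : Measurable (cov : Obs p → Cov p) :=
  measurable_sigma_iff.2 fun n =>
    (measurable_sigma_mk (β := fun n => Fin n → Fin p → ℝ) n).comp
      (measurable_snd.comp measurable_snd)

theorem measurable_treatVec : Measurable (treatVec : Obs p → TreatVec) :=
  measurable_sigma_iff.2 fun n =>
    (measurable_sigma_mk (β := fun n => Fin n → Bool) n).comp
      (measurable_fst.comp measurable_snd)

theorem measurable_unitOutcome (j : ℕ) : Measurable (unitOutcome j : Obs p → ℝ) := by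
  refine measurable_sigma_iff.2 fun n => ?_
  unfold unitOutcome outcome
  by_cases h : j < n
  · simp only [h, dite_true]
    exact ((EuclideanSpace.proj (𝕜 := ℝ) (⟨j, h⟩ : Fin n)).continuous.measurable).comp
      measurable_fst
  · simp only [h, dite_false]
    fun_prop

theorem measurable_obs : Measurable (AugObs.obs : AugObs p r → Obs p) :=
  measurable_sigma_iff.2 fun n => (measurable_sigma_mk n).comp measurable_fst

instance instIsFiniteMeasureComap (P : Measure (Obs p)) [IsFiniteMeasure P] (n : ℕ) :
    IsFiniteMeasure (P.comap (Sigma.mk n : ClusterData p n → Obs p)) := by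
  refine ⟨?_⟩
  rw [(measurableEmbedding_sigma_mk n).comap_apply]
  exact measure_lt_top _ _

/-- Tonelli's theorem on each stratum of fixed cluster size. The total mass and the marginal law of
the cluster both follow from it. -/
theorem lintegral_augLaw (P : Measure (Obs p)) [IsFiniteMeasure P]
    (f : ∀ n : ℕ, PMF (Fin n → Bool)) {F : AugObs p r → ENNReal} (hF : Measurable F) :
    ∫⁻ z, F z ∂(augLaw P f r) =
      ∫⁻ o, ∫⁻ A, F ⟨o.1, o.2, A⟩ ∂(Measure.pi fun _ : Fin r => (f o.1).toMeasure) ∂P := by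
  have hm : Measurable fun o : Obs p =>
      ∫⁻ A, F ⟨o.1, o.2, A⟩ ∂(Measure.pi fun _ : Fin r => (f o.1).toMeasure) := by
    refine measurable_sigma_iff.2 fun n => ?_
    exact (measurable_sigma_iff.1 hF n).lintegral_prod_right'
      (ν := Measure.pi fun _ : Fin r => (f n).toMeasure)
  conv_rhs => rw [← measure_eq_sum_map_comap_sigma_mk P]
  rw [augLaw, lintegral_sum_measure, lintegral_sum_measure]
  congr 1
  ext n
  rw [lintegral_map hF (measurable_sigma_mk n), lintegral_map hm (measurable_sigma_mk n),
    lintegral_prod _ (measurable_sigma_iff.1 hF n).aemeasurable]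

instance instIsProbabilityMeasureAugLaw (P : Measure (Obs p)) [IsProbabilityMeasure P]
    (f : ∀ n : ℕ, PMF (Fin n → Bool)) : IsProbabilityMeasure (augLaw P f r) := by
  refine ⟨?_⟩
  rw [← lintegral_one, lintegral_augLaw P f measurable_const]
  simp

theorem map_obs_augLaw (P : Measure (Obs p)) [IsFiniteMeasure P]
    (f : ∀ n : ℕ, PMF (Fin n → Bool)) : (augLaw P f r).map AugObs.obs = P := by
  refine Measure.ext_of_lintegral _ fun F hF => ?_
  rw [lintegral_map hF measurable_obs,
    lintegral_augLaw (r := r) P f (F := fun z => F z.obs) (hF.comp measurable_obs)]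
  simp [AugObs.obs]

theorem ae_augLaw_obs {P : Measure (Obs p)} [IsFiniteMeasure P]
    (f : ∀ n : ℕ, PMF (Fin n → Bool)) {q : Obs p → Prop} (h : ∀ᵐ o ∂P, q o) :
    ∀ᵐ z ∂(augLaw P f r), q z.obs := by
  rw [← map_obs_augLaw (r := r) P f] at h
  exact ae_of_ae_map measurable_obs.aemeasurable h

theorem integral_augLaw (P : Measure (Obs p)) [IsFiniteMeasure P]
    (f : ∀ n : ℕ, PMF (Fin n → Bool)) {F : AugObs p r → ℝ} (hF : Measurable F)
    (hFi : Integrable F (augLaw P f r)) :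
    Integrable (fun o : Obs p =>
      ∫ A, F ⟨o.1, o.2, A⟩ ∂(Measure.pi fun _ : Fin r => (f o.1).toMeasure)) P ∧
    ∫ z, F z ∂(augLaw P f r) =
      ∫ o, ∫ A, F ⟨o.1, o.2, A⟩ ∂(Measure.pi fun _ : Fin r => (f o.1).toMeasure) ∂P := by
  have hm : Measurable fun o : Obs p =>
      ∫ A, F ⟨o.1, o.2, A⟩ ∂(Measure.pi fun _ : Fin r => (f o.1).toMeasure) := by
    refine measurable_sigma_iff.2 fun n => ?_
    exact ((measurable_sigma_iff.1 hF n).stronglyMeasurable.integral_prod_right'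
      (ν := Measure.pi fun _ : Fin r => (f n).toMeasure)).measurable
  have hi : Integrable (fun o : Obs p =>
      ∫ A, F ⟨o.1, o.2, A⟩ ∂(Measure.pi fun _ : Fin r => (f o.1).toMeasure)) P := by
    refine ⟨hm.aestronglyMeasurable, ?_⟩
    refine lt_of_le_of_lt ?_ hFi.2
    rw [lintegral_augLaw P f hF.enorm]
    exact lintegral_mono fun o => enorm_integral_le_lintegral_enorm _
  refine ⟨hi, ?_⟩
  have hi' := hi
  conv_rhs => rw [← measure_eq_sum_map_comap_sigma_mk P]
  rw [← measure_eq_sum_map_comap_sigma_mk P] at hi'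
  unfold augLaw at hFi ⊢
  rw [integral_sum_measure hFi, integral_sum_measure hi']
  congr 1
  ext n
  have hFn := hFi.mono_measure (Measure.le_sum _ n)
  rw [(measurableEmbedding_sigma_mk n).integrable_map_iff] at hFn
  rw [(measurableEmbedding_sigma_mk n).integral_map, (measurableEmbedding_sigma_mk n).integral_map]
  exact integral_prod _ hFn

/-! ### Integration against the conditional laws of treatment and outcome -/

section CondDistrib

theorem measurable_treatmentProb (P : Measure (Obs p)) [IsFiniteMeasure P] (n : ℕ)
    (a : Fin n → Bool) : Measurable (treatmentProb P n a) := by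
  unfold treatmentProb Measure.real
  have h := Kernel.measurable_coe (condDistrib treatVec cov P)
    (measurableSet_singleton (⟨n, a⟩ : TreatVec))
  exact (measurable_sigma_iff.1 h n).ennreal_toReal

/-- Disintegration of the law of `(X, N)` and the treatment vector along the conditional law of the
latter, which is discrete, so that the inner integral is a finite sum. -/
theorem integrable_and_integral_treatCov (P : Measure (Obs p)) [IsFiniteMeasure P]
    {F : ∀ n : ℕ, (Fin n → Bool) → (Fin n → Fin p → ℝ) → ℝ} (hF : ∀ n a, Measurable (F n a))
    (hFi : Integrable (fun o : Obs p => F o.1 (treat o) (covar o)) P) :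
    Integrable (fun o : Obs p =>
      ∑ a : Fin o.1 → Bool, treatmentProb P o.1 a (covar o) * F o.1 a (covar o)) P ∧
    ∫ o, F o.1 (treat o) (covar o) ∂P =
      ∫ o, ∑ a : Fin o.1 → Bool, treatmentProb P o.1 a (covar o) * F o.1 a (covar o) ∂P := by
  -- The conditional law lives on vectors of every length. Extending `F` by zero to mismatched
  -- lengths avoids having to show that these carry no mass.
  let F' : Cov p × TreatVec → ℝ := fun q =>
    if h : q.2.1 = q.1.1 then F q.1.1 (h ▸ q.2.2) q.1.2 else 0
  have hF' : Measurable F' := by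
    refine measurable_from_prod_countable_left fun t => ?_
    refine measurable_sigma_iff.2 fun n => ?_
    obtain ⟨k, a⟩ := t
    by_cases h : k = n
    · subst h
      simpa [F'] using hF k a
    · simp [F', h]
  have hcomp : ∀ o : Obs p, F o.1 (treat o) (covar o) = F' (cov o, treatVec o) := fun o => by
    simp [F', cov, treatVec]
  have hmap := compProd_map_condDistrib (mβ := inferInstance) (μ := P) (X := (cov : Obs p → Cov p))
    (Y := (treatVec : Obs p → TreatVec)) measurable_treatVec.aemeasurable
  have hpair : Measurable fun o : Obs p => (cov o, treatVec o) :=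
    measurable_cov.prodMk measurable_treatVec
  have hinner : ∀ c : Cov p, ∫ t, F' (c, t) ∂(condDistrib treatVec cov P c) =
      ∑ a : Fin c.1 → Bool, treatmentProb P c.1 a c.2 * F c.1 a c.2 := by
    rintro ⟨n, x⟩
    have : (fun t => F' (⟨n, x⟩, t)) = fun t => ∑ a : Fin n → Bool,
        Set.indicator {(⟨n, a⟩ : TreatVec)} (fun _ => F n a x) t := by
      ext ⟨k, b⟩
      by_cases h : k = n
      · subst h
        rw [Finset.sum_eq_single b]
        · simp [F']
        · intro a _ hab
          rw [Set.indicator_of_notMem]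
          simpa using fun h => hab h.symm
        · simp
      · rw [Finset.sum_eq_zero]
        · simp [F', h]
        · intro a _
          rw [Set.indicator_of_notMem]
          intro hk
          exact h (congrArg Sigma.fst (Set.mem_singleton_iff.1 hk))
    rw [this, integral_finsetSum]
    · refine Finset.sum_congr rfl fun a _ => ?_
      rw [integral_indicator_const _ (measurableSet_singleton _)]
      rfl
    · intro a _
      exact (integrable_const _).indicator (measurableSet_singleton _)
  have hint : Integrable F' ((P.map cov) ⊗ₘ condDistrib treatVec cov P) := by
    rw [hmap, integrable_map_measure hF'.aestronglyMeasurable hpair.aemeasurable]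
    exact hFi.congr (Eventually.of_forall hcomp)
  have h1 := Integrable.integral_condDistrib_map (mβ := inferInstance)
    (X := cov) measurable_treatVec.aemeasurable (hmap ▸ hint)
  simp_rw [hinner] at h1
  have h2 := Measure.integral_compProd hint
  simp_rw [hinner] at h2
  rw [hmap, integral_map hpair.aemeasurable hF'.aestronglyMeasurable,
    integral_map measurable_cov.aemeasurable h1.1] at h2
  refine ⟨h1.comp_measurable measurable_cov, ?_⟩
  simp_rw [hcomp]
  exact h2

/-- The tower property, stated with the conditional distribution because `outcomeRegression` is
defined through it. -/
theorem integrable_and_integral_mul_unitOutcome (P : Measure (Obs p)) [IsFiniteMeasure P] (j : ℕ)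
    {v : TreatCov p → ℝ} (hv : Measurable v)
    (hvi : Integrable (fun o => v (treatCov o) * unitOutcome j o) P) :
    Integrable (fun o => v (treatCov o) *
      ∫ y, y ∂(condDistrib (unitOutcome j) treatCov P (treatCov o))) P ∧
    ∫ o, v (treatCov o) * unitOutcome j o ∂P = ∫ o, v (treatCov o) *
      ∫ y, y ∂(condDistrib (unitOutcome j) treatCov P (treatCov o)) ∂P := by
  have hmap := compProd_map_condDistrib (mβ := inferInstance) (μ := P)
      (X := (treatCov : Obs p → TreatCov p))
    (Y := (unitOutcome j : Obs p → ℝ)) (measurable_unitOutcome j).aemeasurable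
  have hpair : Measurable fun o : Obs p => (treatCov o, unitOutcome j o) :=
    measurable_treatCov.prodMk (measurable_unitOutcome j)
  have hF' : Measurable fun q : TreatCov p × ℝ => v q.1 * q.2 := by fun_prop
  have hint : Integrable (fun q : TreatCov p × ℝ => v q.1 * q.2)
      ((P.map treatCov) ⊗ₘ condDistrib (unitOutcome j) treatCov P) := by
    rw [hmap, integrable_map_measure hF'.aestronglyMeasurable hpair.aemeasurable]
    exact hvi
  have hinner : ∀ c, ∫ y, v c * y ∂(condDistrib (unitOutcome j) treatCov P c) =
      v c * ∫ y, y ∂(condDistrib (unitOutcome j) treatCov P c) := fun c => integral_const_mul _ _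
  have h1 := Integrable.integral_condDistrib_map (mβ := inferInstance)
    (X := treatCov) (f := fun q : TreatCov p × ℝ => v q.1 * q.2)
    (measurable_unitOutcome j).aemeasurable (hmap ▸ hint)
  simp only [hinner] at h1
  have h2 := Measure.integral_compProd hint
  simp only [hinner] at h2
  rw [hmap, integral_map hpair.aemeasurable hF'.aestronglyMeasurable,
    integral_map measurable_treatCov.aemeasurable h1.1] at h2
  exact ⟨h1.comp_measurable measurable_treatCov, h2⟩

theorem measurable_outcomeRegression (P : Measure (Obs p)) [IsFiniteMeasure P] (n : ℕ)
    (a : Fin n → Bool) : Measurable (outcomeRegression P n a) := by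
  refine (PiLp.continuous_toLp 2 fun _ : Fin n => ℝ).measurable.comp ?_
  refine measurable_pi_iff.2 fun j => ?_
  have h : StronglyMeasurable fun c : TreatCov p =>
      ∫ y, y ∂(condDistrib (unitOutcome (j : ℕ)) treatCov P c) :=
    StronglyMeasurable.integral_kernel_prod_right' (f := fun q : TreatCov p × ℝ => q.2)
      measurable_snd.stronglyMeasurable
  have h' := measurable_sigma_iff.1 h.measurable n
  exact h'.comp (measurable_const.prodMk measurable_id)

end CondDistrib

/-! ### Outcome vectors: residuals and conditional second moments -/

section Outcome

/-- The `j`-th coordinate of a vector of length `n`, `0` if `n ≤ j`. -/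
def coordOrZero {n : ℕ} (j : ℕ) (u : EuclideanSpace ℝ (Fin n)) : ℝ :=
  if h : j < n then u ⟨j, h⟩ else 0

theorem measurable_coordOrZero {n : ℕ} (j : ℕ) :
    Measurable (coordOrZero j : EuclideanSpace ℝ (Fin n) → ℝ) := by
  unfold coordOrZero
  by_cases h : j < n
  · simp only [h, dite_true]
    exact (EuclideanSpace.proj (𝕜 := ℝ) (⟨j, h⟩ : Fin n)).continuous.measurable
  · simp only [h, dite_false]
    exact measurable_const

theorem abs_coordOrZero_le {n : ℕ} (j : ℕ) (u : EuclideanSpace ℝ (Fin n)) :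
    |coordOrZero j u| ≤ ‖u‖ := by
  unfold coordOrZero
  split_ifs with h
  · exact PiLp.norm_apply_le u _
  · simp

/-- Padding by zero makes the index range independent of the random cluster size, so that the sum
can be exchanged with an integral over clusters. -/
theorem inner_eq_sum_coordOrZero {n N : ℕ} (h : n ≤ N) (u y : EuclideanSpace ℝ (Fin n)) :
    inner ℝ u y = ∑ j ∈ Finset.range N, coordOrZero j u * coordOrZero j y := by
  rw [PiLp.inner_apply]
  have h1 : ∑ i : Fin n, inner ℝ (u i) (y i) =
      ∑ j ∈ Finset.range n, coordOrZero j u * coordOrZero j y := by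
    rw [← Fin.sum_univ_eq_sum_range]
    refine Finset.sum_congr rfl fun i _ => ?_
    simp [coordOrZero, mul_comm]
  rw [h1]
  refine Finset.sum_subset (Finset.range_mono h) fun j _ hj => ?_
  have : ¬ j < n := by simpa using hj
  simp [coordOrZero, this]

theorem coordOrZero_outcome (j : ℕ) (o : Obs p) : coordOrZero j (outcome o) = unitOutcome j o := rfl

theorem mul_coordOrZero_outcomeRegression (P : Measure (Obs p)) [IsFiniteMeasure P] (j : ℕ)
    (o : Obs p) (u : EuclideanSpace ℝ (Fin o.1)) :
    coordOrZero j u * coordOrZero j (outcomeRegression P o.1 (treat o) (covar o)) =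
      coordOrZero j u * ∫ y, y ∂(condDistrib (unitOutcome j) treatCov P (treatCov o)) := by
  unfold coordOrZero
  split_ifs with h
  · rfl
  · simp

theorem norm_outcome_sq {N : ℕ} {o : Obs p} (h : o.1 ≤ N) :
    ‖outcome o‖ ^ 2 = ∑ j ∈ Finset.range N, unitOutcome j o ^ 2 := by
  rw [← real_inner_self_eq_norm_sq, inner_eq_sum_coordOrZero h]
  simp_rw [coordOrZero_outcome, sq]

variable {P : Measure (Obs p)} [IsFiniteMeasure P] {N : ℕ}

theorem measurable_comp_treatCov {γ : Type*} [MeasurableSpace γ]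
    {F : ∀ n : ℕ, (Fin n → Bool) → (Fin n → Fin p → ℝ) → γ} (hF : ∀ n a, Measurable (F n a)) :
    Measurable fun c : TreatCov p => F c.1 c.2.1 c.2.2 :=
  measurable_sigma_iff.2 fun n => measurable_from_prod_countable_right fun a => hF n a

theorem integral_inner_outcome_sub (hN : ∀ᵐ o ∂P, o.1 ≤ N)
    (hY : ∀ j, Integrable (unitOutcome j) P) {v : VecFun p} (hv : ∀ n a, Measurable (v n a))
    {B : ℝ} (hB : ∀ᵐ o ∂P, ‖v o.1 (treat o) (covar o)‖ ≤ B) :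
    ∫ o, inner ℝ (v o.1 (treat o) (covar o))
      (outcome o - outcomeRegression P o.1 (treat o) (covar o)) ∂P = 0 := by
  let vj : ℕ → TreatCov p → ℝ := fun j c => coordOrZero j (v c.1 c.2.1 c.2.2)
  have hvj : ∀ j, Measurable (vj j) := fun j =>
    measurable_comp_treatCov (F := fun n a x => coordOrZero j (v n a x)) fun n a =>
      (measurable_coordOrZero j).comp (hv n a)
  have hint : ∀ j, Integrable (fun o => vj j (treatCov o) * unitOutcome j o) P := fun j =>
    (hY j).bdd_mul ((hvj j).comp measurable_treatCov).aestronglyMeasurable (c := B) <| by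
      filter_upwards [hB] with o ho
      exact (abs_coordOrZero_le j _).trans ho
  have hkey := fun j => integrable_and_integral_mul_unitOutcome P j (hvj j) (hint j)
  have : ∀ᵐ o ∂P, inner ℝ (v o.1 (treat o) (covar o))
      (outcome o - outcomeRegression P o.1 (treat o) (covar o)) =
      ∑ j ∈ Finset.range N, (vj j (treatCov o) * unitOutcome j o - vj j (treatCov o) *
        ∫ y, y ∂(condDistrib (unitOutcome j) treatCov P (treatCov o))) := by
    filter_upwards [hN] with o ho
    rw [inner_sub_right, inner_eq_sum_coordOrZero ho, inner_eq_sum_coordOrZero ho,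
      ← Finset.sum_sub_distrib]
    refine Finset.sum_congr rfl fun j _ => ?_
    rw [mul_coordOrZero_outcomeRegression]
    rfl
  rw [integral_congr_ae this, integral_finsetSum]
  swap
  · exact fun j _ => (hint j).sub (hkey j).1
  refine Finset.sum_eq_zero fun j _ => ?_
  rw [integral_sub (hint j) (hkey j).1, (hkey j).2, sub_self]

/-- The factor `g` depends on `(A, X, N)` only and can be pulled out of the conditional expectation;
what remains is at most `N` conditional second moments, each bounded by `C`. Thus squared errors may
be multiplied by the unbounded squared outcome at the price of a constant. -/
theorem integral_norm_outcome_sq_mul_le (hN : ∀ᵐ o ∂P, o.1 ≤ N) {C : ℝ}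
    (hY : ∀ j, Integrable (fun o : Obs p => unitOutcome j o ^ 2) P)
    (hYC : ∀ j, ∀ᵐ o ∂P, |(P[fun o' : Obs p => unitOutcome j o' ^ 2 |
      MeasurableSpace.comap treatCov inferInstance]) o| ≤ C)
    {g : Obs p → ℝ}
    (hg : Measurable[MeasurableSpace.comap treatCov inferInstance] g) (hg0 : ∀ o, 0 ≤ g o) {B : ℝ}
    (hB : ∀ᵐ o ∂P, g o ≤ B) :
    Integrable (fun o => ‖outcome o‖ ^ 2 * g o) P ∧
    ∫ o, ‖outcome o‖ ^ 2 * g o ∂P ≤ N * C * ∫ o, g o ∂P := by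
  have hm := measurable_treatCov (p := p)
  have hg' : Measurable g := hg.mono hm.comap_le le_rfl
  have hgi : Integrable (g) P := by
    refine Integrable.of_bound hg'.aestronglyMeasurable B ?_
    filter_upwards [hB] with o ho
    rwa [Real.norm_of_nonneg (hg0 _)]
  have hint : ∀ j, Integrable (fun o => unitOutcome j o ^ 2 * g o) P := fun j =>
    (hY j).mul_bdd (c := B) hg'.aestronglyMeasurable <| by
      filter_upwards [hB] with o ho
      rwa [Real.norm_of_nonneg (hg0 _)]
  have heq : ∀ᵐ o ∂P, ‖outcome o‖ ^ 2 * g o =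
      ∑ j ∈ Finset.range N, unitOutcome j o ^ 2 * g o := by
    filter_upwards [hN] with o ho
    rw [norm_outcome_sq ho, Finset.sum_mul]
  have hle : ∀ j, ∫ o, unitOutcome j o ^ 2 * g o ∂P ≤ C * ∫ o, g o ∂P := by
    intro j
    rw [← integral_condExp hm.comap_le, ← integral_const_mul]
    have hpull := condExp_mul_of_stronglyMeasurable_right
      (m := MeasurableSpace.comap (treatCov : Obs p → TreatCov p) inferInstance) (μ := P)
      (f := fun o => unitOutcome j o ^ 2) (g := g)
      hg.stronglyMeasurable (hint j) (hY j)
    refine integral_mono_ae integrable_condExp (hgi.const_mul C) ?_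
    filter_upwards [hpull, hYC j] with o h1 h2
    refine (le_of_eq h1).trans ?_
    exact mul_le_mul_of_nonneg_right ((le_abs_self _).trans h2) (hg0 _)
  refine ⟨(integrable_finsetSum _ fun j _ => hint j).congr (heq.mono fun _ h => h.symm), ?_⟩
  rw [integral_congr_ae heq, integral_finsetSum _ fun j _ => hint j]
  refine (Finset.sum_le_sum fun j _ => hle j).trans ?_
  simp [mul_assoc]

theorem measurable_comap_treatCov {γ : Type*} [MeasurableSpace γ]
    {F : ∀ n : ℕ, (Fin n → Bool) → (Fin n → Fin p → ℝ) → γ} (hF : ∀ n a, Measurable (F n a)) :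
    Measurable[MeasurableSpace.comap treatCov inferInstance]
      fun o : Obs p => F o.1 (treat o) (covar o) :=
  (measurable_comp_treatCov hF).comp (comap_measurable treatCov)

end Outcome

/-! ### Pointwise bounds at a single cluster -/

section Pointwise

/-- `∑_a ‖(ŵ - w)(a, X, N)‖`. -/
def errWeight (η' η : Nuisance p) (o : Obs p) : ℝ :=
  ∑ a : Fin o.1 → Bool, ‖η'.w o.1 a (covar o) - η.w o.1 a (covar o)‖

/-- The conditional mean of `errPhi` given `(X, N)`. -/
def condErrPhi (η' η : Nuisance p) (o : Obs p) : ℝ :=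
  ∑ a' : Fin o.1 → Bool, η.H o.1 a' (covar o) *
    ∑ a : Fin o.1 → Bool, ‖η'.phi o.1 a' (covar o) a - η.phi o.1 a' (covar o) a‖

theorem errH_nonneg (η' η : Nuisance p) (o : Obs p) : 0 ≤ errH η' η o :=
  Finset.sum_nonneg fun _ _ => abs_nonneg _

theorem errG_nonneg (η' η : Nuisance p) (o : Obs p) : 0 ≤ errG η' η o :=
  Finset.sum_nonneg fun _ _ => norm_nonneg _

theorem errPhi_nonneg (η' η : Nuisance p) (o : Obs p) : 0 ≤ errPhi η' η o :=
  Finset.sum_nonneg fun _ _ => norm_nonneg _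

theorem errW_nonneg (η' η : Nuisance p) (o : Obs p) : 0 ≤ errW η' η o :=
  Finset.sum_nonneg fun _ _ => norm_nonneg _

theorem errWeight_nonneg (η' η : Nuisance p) (o : Obs p) : 0 ≤ errWeight η' η o :=
  Finset.sum_nonneg fun _ _ => norm_nonneg _

variable {η' η : Nuisance p} {c C : ℝ} {o : Obs p}

theorem condErrPhi_nonneg (hη : ∀ a, 0 ≤ η.H o.1 a (covar o)) : 0 ≤ condErrPhi η' η o :=
  Finset.sum_nonneg fun a _ => mul_nonneg (hη a) (Finset.sum_nonneg fun _ _ => norm_nonneg _)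

/-- By the centering of `φ`, averaging `φ̂` over `H` is the same as averaging `φ̂ - φ`. The
estimated weight therefore needs no rate of its own: its error is inherited from `errW` and the
error of `φ̂`. -/
theorem errWeight_le (hη : ∀ a, 0 ≤ η.H o.1 a (covar o))
    (hcent : ∀ a : Fin o.1 → Bool,
      ∑ a' : Fin o.1 → Bool, η.H o.1 a' (covar o) • η.phi o.1 a' (covar o) a = 0) :
    errWeight η' η o ≤ errW η' η o + condErrPhi η' η o := by
  have hswap : condErrPhi η' η o = ∑ a : Fin o.1 → Bool, ∑ a' : Fin o.1 → Bool,
      η.H o.1 a' (covar o) * ‖η'.phi o.1 a' (covar o) a - η.phi o.1 a' (covar o) a‖ := by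
    rw [Finset.sum_comm]
    simp only [condErrPhi, Finset.mul_sum]
  rw [hswap, errWeight, errW, ← Finset.sum_add_distrib]
  refine Finset.sum_le_sum fun a _ => ?_
  set S := ∑ a' : Fin o.1 → Bool, η.H o.1 a' (covar o) • η'.phi o.1 a' (covar o) a with hS
  have h1 : ‖S‖ ≤ ∑ a' : Fin o.1 → Bool, η.H o.1 a' (covar o) *
      ‖η'.phi o.1 a' (covar o) a - η.phi o.1 a' (covar o) a‖ := by
    have : S = ∑ a' : Fin o.1 → Bool, η.H o.1 a' (covar o) •
        (η'.phi o.1 a' (covar o) a - η.phi o.1 a' (covar o) a) := by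
      simp only [smul_sub, Finset.sum_sub_distrib, hcent, sub_zero, hS]
    rw [this]
    refine (norm_sum_le _ _).trans (Finset.sum_le_sum fun a' _ => ?_)
    rw [norm_smul, Real.norm_of_nonneg (hη a')]
  calc ‖η'.w o.1 a (covar o) - η.w o.1 a (covar o)‖
      = ‖(η'.w o.1 a (covar o) - η.w o.1 a (covar o) + S) - S‖ := by rw [add_sub_cancel_right]
    _ ≤ _ := (norm_sub_le _ _).trans (by gcongr)

theorem norm_w_sub_le (a : Fin o.1 → Bool) :
    ‖η'.w o.1 a (covar o) - η.w o.1 a (covar o)‖ ≤ errWeight η' η o :=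
  Finset.single_le_sum (f := fun a => ‖η'.w o.1 a (covar o) - η.w o.1 a (covar o)‖)
    (fun _ _ => norm_nonneg _) (Finset.mem_univ a)

theorem norm_G_sub_le (a : Fin o.1 → Bool) :
    ‖η'.G o.1 a (covar o) - η.G o.1 a (covar o)‖ ≤ errG η' η o :=
  Finset.single_le_sum (f := fun a => ‖η'.G o.1 a (covar o) - η.G o.1 a (covar o)‖)
    (fun _ _ => norm_nonneg _) (Finset.mem_univ a)

theorem abs_H_sub_le (a : Fin o.1 → Bool) :
    |η'.H o.1 a (covar o) - η.H o.1 a (covar o)| ≤ errH η' η o :=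
  Finset.single_le_sum (f := fun a => |η'.H o.1 a (covar o) - η.H o.1 a (covar o)|)
    (fun _ _ => abs_nonneg _) (Finset.mem_univ a)

theorem norm_phi_sub_le (a : Fin o.1 → Bool) :
    ‖η'.phi o.1 (treat o) (covar o) a - η.phi o.1 (treat o) (covar o) a‖ ≤ errPhi η' η o :=
  Finset.single_le_sum
    (f := fun a => ‖η'.phi o.1 (treat o) (covar o) a - η.phi o.1 (treat o) (covar o) a‖)
    (fun _ _ => norm_nonneg _) (Finset.mem_univ a)

theorem abs_hTerm_le (hC : 0 ≤ C) (h : η.BoundedAt c C o) (a : Fin o.1 → Bool) :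
    |hTerm η o a| ≤ 2 * C ^ 2 := by
  refine (abs_real_inner_le_norm _ _).trans ?_
  calc ‖η.w o.1 a (covar o) + η.phi o.1 (treat o) (covar o) a‖ * ‖η.G o.1 a (covar o)‖
      ≤ (C + C) * C := mul_le_mul ((norm_add_le _ _).trans (add_le_add (h.w a) (h.phi _ a))) (h.G a)
        (norm_nonneg _) (by positivity)
    _ = 2 * C ^ 2 := by ring

theorem abs_lTerm_le (hc : 0 < c) (hC : 0 ≤ C) (h : η.BoundedAt c C o) :
    |lTerm η o| ≤ C * (‖outcome o‖ + C) / c := by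
  rw [lTerm, abs_div]
  have hH := (h.H (treat o)).1
  refine div_le_div₀ (by positivity) ((abs_real_inner_le_norm _ _).trans ?_) hc
    (hH.le.trans (le_abs_self _))
  exact mul_le_mul (h.w _) ((norm_sub_le _ _).trans (add_le_add le_rfl (h.G _)))
    (norm_nonneg _) hC

theorem abs_hTerm_sub_le (hC : 0 ≤ C) (h' : η'.BoundedAt c C o) (h : η.BoundedAt c C o)
    (a : Fin o.1 → Bool) :
    |hTerm η' o a - hTerm η o a| ≤
      C * (errWeight η' η o + errPhi η' η o) + 2 * C * errG η' η o := by
  set u' := η'.w o.1 a (covar o) + η'.phi o.1 (treat o) (covar o) a with hu'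
  set u := η.w o.1 a (covar o) + η.phi o.1 (treat o) (covar o) a with hu
  set v' := η'.G o.1 a (covar o)
  set v := η.G o.1 a (covar o)
  have heq : hTerm η' o a - hTerm η o a = inner ℝ (u' - u) v' + inner ℝ u (v' - v) := by
    change inner ℝ u' v' - inner ℝ u v = _
    rw [inner_sub_left, inner_sub_right]
    ring
  have h1 : ‖u' - u‖ ≤ errWeight η' η o + errPhi η' η o := by
    rw [hu', hu, add_sub_add_comm]
    exact (norm_add_le _ _).trans (add_le_add (norm_w_sub_le a) (norm_phi_sub_le a))
  have h2 : ‖u‖ ≤ 2 * C := by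
    rw [two_mul]
    exact (norm_add_le _ _).trans (add_le_add (h.w a) (h.phi _ a))
  rw [heq]
  refine (abs_add_le _ _).trans (add_le_add ((abs_real_inner_le_norm _ _).trans ?_)
    ((abs_real_inner_le_norm _ _).trans ?_))
  · rw [mul_comm C]
    exact mul_le_mul h1 (h'.G a) (norm_nonneg _) ((norm_nonneg _).trans h1)
  · exact mul_le_mul h2 (norm_G_sub_le a) (norm_nonneg _) (by positivity)

theorem abs_lTerm_sub_le (hc : 0 < c) (hC : 0 ≤ C) (h' : η'.BoundedAt c C o)
    (h : η.BoundedAt c C o) :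
    |lTerm η' o - lTerm η o| ≤ (‖outcome o‖ + C) / c * errWeight η' η o +
      C / c * errG η' η o + C * (‖outcome o‖ + C) / c ^ 2 * errH η' η o := by
  have hw := norm_w_sub_le (η' := η') (η := η) (treat o)
  have hG := norm_G_sub_le (η' := η') (η := η) (treat o)
  have hH := abs_H_sub_le (η' := η') (η := η) (treat o)
  have hH1 := (h.H (treat o)).1
  have hH1' := (h'.H (treat o)).1
  have hw1 := h.w (treat o)
  have hG1 := h.G (treat o)
  have hG1' := h'.G (treat o)
  unfold lTerm
  set w' := η'.w o.1 (treat o) (covar o)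
  set w := η.w o.1 (treat o) (covar o)
  set G' := η'.G o.1 (treat o) (covar o)
  set G := η.G o.1 (treat o) (covar o)
  set H' := η'.H o.1 (treat o) (covar o)
  set H := η.H o.1 (treat o) (covar o)
  set Y := outcome o
  have hHpos : 0 < H := hc.trans hH1
  have hHpos' : 0 < H' := hc.trans hH1'
  -- Telescoping: `w`, then `G`, then `H` is exchanged. The outcome enters each piece at most
  -- linearly.
  have heq : inner ℝ w' (Y - G') / H' - inner ℝ w (Y - G) / H =
      inner ℝ (w' - w) (Y - G') / H' - inner ℝ w (G' - G) / H' -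
        inner ℝ w (Y - G) * (H' - H) / (H' * H) := by
    simp only [inner_sub_left, inner_sub_right]
    field_simp
    ring
  have e1 : |inner ℝ (w' - w) (Y - G') / H'| ≤ (‖Y‖ + C) / c * errWeight η' η o := by
    rw [abs_div, abs_of_pos hHpos', div_mul_eq_mul_div]
    refine div_le_div₀ (by have := errWeight_nonneg η' η o; positivity)
      ((abs_real_inner_le_norm _ _).trans ?_) hc hH1'.le
    rw [mul_comm]
    exact mul_le_mul ((norm_sub_le _ _).trans (add_le_add le_rfl hG1')) hw (norm_nonneg _)
      (by positivity)
  have e2 : |inner ℝ w (G' - G) / H'| ≤ C / c * errG η' η o := by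
    rw [abs_div, abs_of_pos hHpos', div_mul_eq_mul_div]
    refine div_le_div₀ (by have := errG_nonneg η' η o; positivity)
      ((abs_real_inner_le_norm _ _).trans ?_) hc hH1'.le
    exact mul_le_mul hw1 hG (norm_nonneg _) hC
  have e3 : |inner ℝ w (Y - G) * (H' - H) / (H' * H)| ≤
      C * (‖Y‖ + C) / c ^ 2 * errH η' η o := by
    rw [abs_div, abs_mul, abs_of_pos (mul_pos hHpos' hHpos), div_mul_eq_mul_div]
    refine div_le_div₀ (by have := errH_nonneg η' η o; positivity) ?_ (by positivity) ?_
    · refine mul_le_mul ((abs_real_inner_le_norm _ _).trans ?_) hH (abs_nonneg _) (by positivity)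
      exact mul_le_mul hw1 ((norm_sub_le _ _).trans (add_le_add le_rfl hG1)) (norm_nonneg _) hC
    · rw [sq]
      exact mul_le_mul hH1'.le hH1.le hc.le hHpos'.le
  rw [heq]
  refine (abs_sub _ _).trans (add_le_add ((abs_sub _ _).trans (add_le_add e1 e2)) e3)

/-- The conditional bias of the uncentered influence function given `(X, N)`. -/
def condBias (η' η : Nuisance p) (o : Obs p) : ℝ :=
  (∑ a' : Fin o.1 → Bool, η.H o.1 a' (covar o) * ∑ a : Fin o.1 → Bool,
    inner ℝ (η'.w o.1 a (covar o) + η'.phi o.1 a' (covar o) a) (η'.G o.1 a (covar o))) +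
  (∑ a : Fin o.1 → Bool, η.H o.1 a (covar o) *
    inner ℝ ((η'.H o.1 a (covar o))⁻¹ • η'.w o.1 a (covar o))
      (η.G o.1 a (covar o) - η'.G o.1 a (covar o))) -
  ∑ a : Fin o.1 → Bool, inner ℝ (η.w o.1 a (covar o)) (η.G o.1 a (covar o))

/-- Double robustness. Since `H` sums to one, the bias rearranges exactly, treatment by treatment,
so that no error of `Ĝ` or `Ĥ` appears alone; the only term that is not a product of errors is the
remainder `errW`. -/
theorem abs_condBias_le (hc : 0 < c) (hC : 0 ≤ C) (h' : η'.BoundedAt c C o)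
    (hsum : ∑ a : Fin o.1 → Bool, η.H o.1 a (covar o) = 1) :
    |condBias η' η o| ≤ C * errW η' η o + C / c * (errH η' η o * errG η' η o) +
      errWeight η' η o * errG η' η o := by
  have heq : condBias η' η o = ∑ a : Fin o.1 → Bool,
      (inner ℝ (η'.w o.1 a (covar o) - η.w o.1 a (covar o) + ∑ a' : Fin o.1 → Bool,
          η.H o.1 a' (covar o) • η'.phi o.1 a' (covar o) a) (η'.G o.1 a (covar o)) +
        (η'.H o.1 a (covar o) - η.H o.1 a (covar o)) / η'.H o.1 a (covar o) *
          inner ℝ (η'.w o.1 a (covar o)) (η'.G o.1 a (covar o) - η.G o.1 a (covar o)) -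
        inner ℝ (η'.w o.1 a (covar o) - η.w o.1 a (covar o))
          (η'.G o.1 a (covar o) - η.G o.1 a (covar o))) := by
    have h1 : ∑ a' : Fin o.1 → Bool, η.H o.1 a' (covar o) * ∑ a : Fin o.1 → Bool,
        inner ℝ (η'.w o.1 a (covar o) + η'.phi o.1 a' (covar o) a) (η'.G o.1 a (covar o)) =
        ∑ a : Fin o.1 → Bool, inner ℝ (η'.w o.1 a (covar o) + ∑ a' : Fin o.1 → Bool,
          η.H o.1 a' (covar o) • η'.phi o.1 a' (covar o) a) (η'.G o.1 a (covar o)) := by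
      simp only [Finset.mul_sum]
      rw [Finset.sum_comm]
      refine Finset.sum_congr rfl fun a _ => ?_
      simp only [inner_add_left, mul_add, Finset.sum_add_distrib, ← Finset.sum_mul, hsum, one_mul,
        sum_inner, real_inner_smul_left]
    rw [condBias, h1, ← Finset.sum_add_distrib, ← Finset.sum_sub_distrib]
    refine Finset.sum_congr rfl fun a _ => ?_
    have hpos : η'.H o.1 a (covar o) ≠ 0 := (hc.trans (h'.H a).1).ne'
    simp only [inner_add_left, inner_sub_left, inner_sub_right, real_inner_smul_left]
    field_simp
    ring
  rw [heq]
  refine (Finset.abs_sum_le_sum_abs _ _).trans ?_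
  have hb : ∀ a : Fin o.1 → Bool, |_| ≤ _ := fun a => (abs_sub (inner ℝ (η'.w o.1 a (covar o) -
      η.w o.1 a (covar o) + ∑ a' : Fin o.1 → Bool,
          η.H o.1 a' (covar o) • η'.phi o.1 a' (covar o) a) (η'.G o.1 a (covar o)) +
        (η'.H o.1 a (covar o) - η.H o.1 a (covar o)) / η'.H o.1 a (covar o) *
          inner ℝ (η'.w o.1 a (covar o)) (η'.G o.1 a (covar o) - η.G o.1 a (covar o)))
        (inner ℝ (η'.w o.1 a (covar o) - η.w o.1 a (covar o))
          (η'.G o.1 a (covar o) - η.G o.1 a (covar o)))).trans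
      (add_le_add (abs_add_le _ _) le_rfl)
  refine (Finset.sum_le_sum fun a _ => hb a).trans ?_
  rw [Finset.sum_add_distrib, Finset.sum_add_distrib]
  refine add_le_add (add_le_add ?_ ?_) ?_
  · rw [errW, Finset.mul_sum]
    refine Finset.sum_le_sum fun a _ => (abs_real_inner_le_norm _ _).trans ?_
    rw [mul_comm]
    exact mul_le_mul_of_nonneg_right (h'.G a) (norm_nonneg _)
  · rw [errH, Finset.sum_mul, Finset.mul_sum]
    refine Finset.sum_le_sum fun a _ => ?_
    have hpos := hc.trans (h'.H a).1
    rw [abs_mul, abs_div, abs_of_pos hpos]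
    have e1 : |η'.H o.1 a (covar o) - η.H o.1 a (covar o)| / η'.H o.1 a (covar o) ≤
        |η'.H o.1 a (covar o) - η.H o.1 a (covar o)| / c :=
      div_le_div_of_nonneg_left (abs_nonneg _) hc (h'.H a).1.le
    have e2 : |inner ℝ (η'.w o.1 a (covar o)) (η'.G o.1 a (covar o) - η.G o.1 a (covar o))| ≤
        C * errG η' η o := (abs_real_inner_le_norm _ _).trans
      (mul_le_mul (h'.w a) (norm_G_sub_le a) (norm_nonneg _) hC)
    refine (mul_le_mul e1 e2 (abs_nonneg _) (by positivity)).trans (le_of_eq ?_)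
    ring
  · rw [errWeight, Finset.sum_mul]
    exact Finset.sum_le_sum fun a _ => (abs_real_inner_le_norm _ _).trans
      (mul_le_mul_of_nonneg_left (norm_G_sub_le a) (norm_nonneg _))

/-- Jensen's inequality for the probability weights `H`, derived from Cauchy–Schwarz. -/
theorem sq_condErrPhi_le (hη : ∀ a, 0 ≤ η.H o.1 a (covar o))
    (hsum : ∑ a : Fin o.1 → Bool, η.H o.1 a (covar o) = 1) :
    condErrPhi η' η o ^ 2 ≤ ∑ a' : Fin o.1 → Bool, η.H o.1 a' (covar o) *
      (∑ a : Fin o.1 → Bool, ‖η'.phi o.1 a' (covar o) a - η.phi o.1 a' (covar o) a‖) ^ 2 := by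
  have := Finset.sum_sq_le_sum_mul_sum_of_sq_le_mul (Finset.univ : Finset (Fin o.1 → Bool))
    (r := fun a' => η.H o.1 a' (covar o) *
      ∑ a : Fin o.1 → Bool, ‖η'.phi o.1 a' (covar o) a - η.phi o.1 a' (covar o) a‖)
    (f := fun a' => η.H o.1 a' (covar o))
    (g := fun a' => η.H o.1 a' (covar o) *
      (∑ a : Fin o.1 → Bool, ‖η'.phi o.1 a' (covar o) a - η.phi o.1 a' (covar o) a‖) ^ 2)
    (fun a' _ => hη a') (fun a' _ => mul_nonneg (hη a') (sq_nonneg _))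
    (fun a' _ => le_of_eq (by ring))
  rwa [hsum, one_mul] at this

end Pointwise

/-! ### Joint measurability in the training data and the evaluation point -/

section Measurability

/-- Joint measurability of a family of nuisance functions. -/
structure IsMeasurableFamily {T : Type*} [MeasurableSpace T] (η : T → Nuisance p) : Prop where
  G : ∀ n a, Measurable fun t : T × (Fin n → Fin p → ℝ) => (η t.1).G n a t.2
  H : ∀ n a, Measurable fun t : T × (Fin n → Fin p → ℝ) => (η t.1).H n a t.2
  w : ∀ n a, Measurable fun t : T × (Fin n → Fin p → ℝ) => (η t.1).w n a t.2
  phi : ∀ n a' a, Measurable fun t : T × (Fin n → Fin p → ℝ) => (η t.1).phi n a' t.2 a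

/-- Measurability of nuisance functions. -/
structure Nuisance.IsMeasurable (η : Nuisance p) : Prop where
  G : ∀ n a, Measurable (η.G n a)
  H : ∀ n a, Measurable (η.H n a)
  w : ∀ n a, Measurable (η.w n a)
  phi : ∀ n a' a, Measurable fun x => η.phi n a' x a

variable {T : Type*} [MeasurableSpace T] {η : T → Nuisance p}

theorem IsMeasurableFamily.isMeasurable (h : IsMeasurableFamily η) (t : T) :
    (η t).IsMeasurable where
  G n a := (h.G n a).comp measurable_prodMk_left
  H n a := (h.H n a).comp measurable_prodMk_left
  w n a := (h.w n a).comp measurable_prodMk_left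
  phi n a' a := (h.phi n a' a).comp measurable_prodMk_left

theorem Nuisance.IsMeasurable.const {η : Nuisance p} (h : η.IsMeasurable) :
    IsMeasurableFamily fun _ : T => η where
  G n a := (h.G n a).comp measurable_snd
  H n a := (h.H n a).comp measurable_snd
  w n a := (h.w n a).comp measurable_snd
  phi n a' a := (h.phi n a' a).comp measurable_snd

theorem IsMeasurableFamily.measurable_hTerm (h : IsMeasurableFamily η) (n : ℕ) :
    Measurable fun u : (T × ClusterData p n) × (Fin n → Bool) =>
      hTerm (η u.1.1) ⟨n, u.1.2⟩ u.2 := by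
  refine measurable_from_prod_countable_left fun a => ?_
  have hx : Measurable fun u : T × ClusterData p n => (u.1, u.2.2.2) := by fun_prop
  have hphi : Measurable fun u : T × ClusterData p n => (η u.1).phi n u.2.2.1 u.2.2.2 a :=
    (measurable_from_prod_countable_left (f := fun v : (T × (Fin n → Fin p → ℝ)) × (Fin n → Bool) =>
      (η v.1.1).phi n v.2 v.1.2 a) fun a' => h.phi n a' a).comp
      (hx.prodMk (measurable_fst.comp (measurable_snd.comp measurable_snd)))
  exact (((h.w n a).comp hx).add hphi).inner ((h.G n a).comp hx)

theorem IsMeasurableFamily.measurable_lTerm (h : IsMeasurableFamily η) :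
    Measurable fun u : T × Obs p => lTerm (η u.1) u.2 := by
  refine measurable_prod_sigma_iff.2 fun n => ?_
  have hx : Measurable fun u : T × ClusterData p n => ((u.1, u.2.2.2), u.2.2.1) := by fun_prop
  have hw' : Measurable fun v : (T × (Fin n → Fin p → ℝ)) × (Fin n → Bool) =>
      (η v.1.1).w n v.2 v.1.2 := measurable_from_prod_countable_left fun a => h.w n a
  have hG' : Measurable fun v : (T × (Fin n → Fin p → ℝ)) × (Fin n → Bool) =>
      (η v.1.1).G n v.2 v.1.2 := measurable_from_prod_countable_left fun a => h.G n a
  have hH' : Measurable fun v : (T × (Fin n → Fin p → ℝ)) × (Fin n → Bool) =>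
      (η v.1.1).H n v.2 v.1.2 := measurable_from_prod_countable_left fun a => h.H n a
  have hw : Measurable fun u : T × ClusterData p n => (η u.1).w n u.2.2.1 u.2.2.2 :=
    hw'.comp hx
  have hG : Measurable fun u : T × ClusterData p n => (η u.1).G n u.2.2.1 u.2.2.2 :=
    hG'.comp hx
  have hH : Measurable fun u : T × ClusterData p n => (η u.1).H n u.2.2.1 u.2.2.2 :=
    hH'.comp hx
  have hY : Measurable fun u : T × ClusterData p n => u.2.1 := by fun_prop
  exact (hw.inner (hY.sub hG)).div hH

theorem IsMeasurableFamily.measurable_approxIF (h : IsMeasurableFamily η)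
    (f : ∀ n : ℕ, PMF (Fin n → Bool)) :
    Measurable fun u : T × AugObs p r => approxIF f (η u.1) u.2 := by
  refine Measurable.add (Measurable.const_mul (Finset.measurable_fun_sum _ fun q _ => ?_) _) ?_
  · refine measurable_prod_sigma_iff.2 fun n => ?_
    have hq : Measurable fun u : T × (ClusterData p n × (Fin r → Fin n → Bool)) => u.2.2 q := by
      fun_prop
    have hq' : Measurable fun u : T × (ClusterData p n × (Fin r → Fin n → Bool)) =>
        ((u.1, u.2.1), u.2.2 q) := by fun_prop
    have hf : Measurable fun a : Fin n → Bool => (f n a).toReal := measurable_of_countable _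
    have h1 : Measurable fun u : T × (ClusterData p n × (Fin r → Fin n → Bool)) =>
        hTerm (η u.1) ⟨n, u.2.1⟩ (u.2.2 q) := by
      have := (h.measurable_hTerm n).comp hq'
      exact this
    have h2 : Measurable fun u : T × (ClusterData p n × (Fin r → Fin n → Bool)) =>
        (f n (u.2.2 q)).toReal := hf.comp hq
    exact h1.div h2
  · exact h.measurable_lTerm.comp
      (measurable_fst.prodMk (measurable_obs.comp measurable_snd))

end Measurability

/-! ### Measurability and uniform bounds of the errors -/

section Errors

variable {η η' : Nuisance p}

theorem Nuisance.IsMeasurable.measurable_approxIF (h : η.IsMeasurable)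
    (f : ∀ n : ℕ, PMF (Fin n → Bool)) : Measurable (approxIF f η : AugObs p r → ℝ) := by
  have := ((h.const (T := Unit)).measurable_approxIF (r := r) f).comp
    (measurable_prodMk_left (x := ()))
  exact this

theorem Nuisance.IsMeasurable.measurable_lTerm (h : η.IsMeasurable) : Measurable (lTerm η) := by
  have := (h.const (T := Unit)).measurable_lTerm.comp (measurable_prodMk_left (x := ()))
  exact this

/-- Here and for the other errors the σ-algebra is that of `(A, X, N)`, so that they can be pulled
out of conditional expectations of the outcomes. -/
theorem measurable_errH (h' : η'.IsMeasurable) (h : η.IsMeasurable) :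
    Measurable[MeasurableSpace.comap treatCov inferInstance] (errH η' η) :=
  measurable_comap_treatCov (F := fun n _ x => ∑ a, |η'.H n a x - η.H n a x|) fun n _ =>
    Finset.measurable_fun_sum _ fun a _ => by
      have := h'.H n a; have := h.H n a; fun_prop

theorem measurable_errG (h' : η'.IsMeasurable) (h : η.IsMeasurable) :
    Measurable[MeasurableSpace.comap treatCov inferInstance] (errG η' η) :=
  measurable_comap_treatCov (F := fun n _ x => ∑ a, ‖η'.G n a x - η.G n a x‖) fun n _ =>
    Finset.measurable_fun_sum _ fun a _ => ((h'.G n a).sub (h.G n a)).norm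

theorem measurable_errPhi (h' : η'.IsMeasurable) (h : η.IsMeasurable) :
    Measurable[MeasurableSpace.comap treatCov inferInstance] (errPhi η' η) :=
  measurable_comap_treatCov (F := fun n a' x => ∑ a, ‖η'.phi n a' x a - η.phi n a' x a‖)
    fun n a' => Finset.measurable_fun_sum _ fun a _ => ((h'.phi n a' a).sub (h.phi n a' a)).norm

theorem measurable_errW (h' : η'.IsMeasurable) (h : η.IsMeasurable) :
    Measurable[MeasurableSpace.comap treatCov inferInstance] (errW η' η) :=
  measurable_comap_treatCov (F := fun n _ x => ∑ a : Fin n → Bool, ‖η'.w n a x - η.w n a x +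
    ∑ a' : Fin n → Bool, η.H n a' x • η'.phi n a' x a‖)
    fun n _ => Finset.measurable_fun_sum _ fun a _ => (((h'.w n a).sub (h.w n a)).add
      (Finset.measurable_fun_sum _ fun a' _ => (h.H n a').smul (h'.phi n a' a))).norm

theorem measurable_condErrPhi (h' : η'.IsMeasurable) (h : η.IsMeasurable) :
    Measurable[MeasurableSpace.comap treatCov inferInstance] (condErrPhi η' η) :=
  measurable_comap_treatCov (F := fun n _ x => ∑ a' : Fin n → Bool, η.H n a' x *
    ∑ a : Fin n → Bool, ‖η'.phi n a' x a - η.phi n a' x a‖)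
    fun n _ => Finset.measurable_fun_sum _ fun a' _ => (h.H n a').mul
      (Finset.measurable_fun_sum _ fun a _ => ((h'.phi n a' a).sub (h.phi n a' a)).norm)

variable {c C : ℝ} {o : Obs p} {N : ℕ}

theorem sum_treatment_le {n : ℕ} (hn : n ≤ N) {F : (Fin n → Bool) → ℝ} {B : ℝ} (hB : 0 ≤ B)
    (hF : ∀ a, F a ≤ B) : ∑ a, F a ≤ 2 ^ N * B := by
  refine (Finset.sum_le_card_nsmul _ _ B fun a _ => hF a).trans ?_
  rw [nsmul_eq_mul]
  refine mul_le_mul_of_nonneg_right ?_ hB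
  simp only [Finset.card_univ, Fintype.card_pi, Fintype.card_bool, Finset.prod_const,
    Fintype.card_fin, Nat.cast_pow, Nat.cast_ofNat]
  exact pow_le_pow_right₀ (by norm_num) hn

theorem errH_le (hN : o.1 ≤ N) (hc : 0 < c) (h' : η'.BoundedAt c C o) (h : η.BoundedAt c C o) :
    errH η' η o ≤ 2 ^ N * 1 :=
  sum_treatment_le hN zero_le_one fun a => by
    have h1 := h'.H a
    have h2 := h.H a
    rw [Set.mem_Ioo] at h1 h2
    exact abs_le.2 ⟨by linarith, by linarith⟩

theorem errG_le (hN : o.1 ≤ N) (hC : 0 ≤ C) (h' : η'.BoundedAt c C o) (h : η.BoundedAt c C o) :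
    errG η' η o ≤ 2 ^ N * (C + C) :=
  sum_treatment_le hN (by positivity) fun a =>
    (norm_sub_le _ _).trans (add_le_add (h'.G a) (h.G a))

theorem errPhi_le (hN : o.1 ≤ N) (hC : 0 ≤ C) (h' : η'.BoundedAt c C o) (h : η.BoundedAt c C o) :
    errPhi η' η o ≤ 2 ^ N * (C + C) :=
  sum_treatment_le hN (by positivity) fun a =>
    (norm_sub_le _ _).trans (add_le_add (h'.phi _ a) (h.phi _ a))

theorem errW_le (hN : o.1 ≤ N) (hc : 0 < c) (hC : 0 ≤ C) (h' : η'.BoundedAt c C o)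
    (h : η.BoundedAt c C o) : errW η' η o ≤ 2 ^ N * (C + C + 2 ^ N * C) :=
  sum_treatment_le hN (by positivity) fun a => by
    refine (norm_add_le _ _).trans (add_le_add
      ((norm_sub_le _ _).trans (add_le_add (h'.w a) (h.w a))) ((norm_sum_le _ _).trans ?_))
    refine sum_treatment_le hN hC fun a' => ?_
    have h1 := h.H a'
    rw [Set.mem_Ioo] at h1
    rw [norm_smul, Real.norm_of_nonneg (hc.le.trans h1.1.le)]
    calc _ ≤ 1 * C := mul_le_mul (by linarith) (h'.phi a' a) (norm_nonneg _) zero_le_one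
      _ = C := one_mul C

theorem condErrPhi_le (hN : o.1 ≤ N) (hc : 0 < c) (hC : 0 ≤ C) (h' : η'.BoundedAt c C o)
    (h : η.BoundedAt c C o) : condErrPhi η' η o ≤ 2 ^ N * (2 ^ N * (C + C)) :=
  sum_treatment_le hN (by positivity) fun a' => by
    have h1 := h.H a'
    rw [Set.mem_Ioo] at h1
    calc _ ≤ 1 * (2 ^ N * (C + C)) := mul_le_mul (by linarith)
          (sum_treatment_le hN (by positivity) fun a =>
            (norm_sub_le _ _).trans (add_le_add (h'.phi _ a) (h.phi _ a)))
          (Finset.sum_nonneg fun _ _ => norm_nonneg _) zero_le_one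
      _ = _ := one_mul _

end Errors

/-- Measurable nuisance functions within the bounds, `P`-almost everywhere. -/
structure IsAdmissible (P : Measure (Obs p)) (c C : ℝ) (η : Nuisance p) : Prop where
  meas : η.IsMeasurable
  bounded : ∀ᵐ o ∂P, η.BoundedAt c C o

/-- The nuisance functions `η` are those of `P`, up to the weight and its influence function, and
they satisfy the regularity conditions. -/
structure IsRegularModel (P : Measure (Obs p)) [IsProbabilityMeasure P] (η : Nuisance p)
    (c C : ℝ) (N : ℕ) : Prop extends IsAdmissible P c C η where
  G_eq : η.G = outcomeRegression P
  H_eq : η.H = treatmentProb P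
  c_pos : 0 < c
  C_pos : 0 < C
  size : ∀ᵐ o ∂P, o.1 ≤ N
  integrable_outcome : ∀ j, Integrable (unitOutcome j) P
  integrable_outcome_sq : ∀ j, Integrable (fun o : Obs p => unitOutcome j o ^ 2) P
  moment : ∀ j, ∀ᵐ o ∂P, |(P[fun o' : Obs p => unitOutcome j o' ^ 2 |
      MeasurableSpace.comap treatCov inferInstance]) o| ≤ C
  centered : ∀ᵐ o ∂P, ∀ a : Fin o.1 → Bool,
    ∑ a' : Fin o.1 → Bool, η.H o.1 a' (covar o) • η.phi o.1 a' (covar o) a = 0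

/-! ### Cauchy–Schwarz for `l2norm` -/

section L2norm

variable {P : Measure (Obs p)} {g g₁ g₂ : Obs p → ℝ}

theorem l2norm_nonneg : 0 ≤ l2norm P g := Real.sqrt_nonneg _

theorem l2norm_sq : l2norm P g ^ 2 = ∫ o, g o ^ 2 ∂P :=
  Real.sq_sqrt (integral_nonneg fun _ => sq_nonneg _)

theorem integral_mul_le_l2norm_mul (h₁ : MemLp g₁ 2 P) (h₂ : MemLp g₂ 2 P) (h₁0 : ∀ o, 0 ≤ g₁ o)
    (h₂0 : ∀ o, 0 ≤ g₂ o) : ∫ o, g₁ o * g₂ o ∂P ≤ l2norm P g₁ * l2norm P g₂ := by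
  have := integral_mul_le_Lp_mul_Lq_of_nonneg (μ := P) Real.HolderConjugate.two_two
    (Eventually.of_forall h₁0) (Eventually.of_forall h₂0) (by simpa using h₁) (by simpa using h₂)
  simpa [l2norm, Real.sqrt_eq_rpow] using this

theorem integral_le_l2norm [IsProbabilityMeasure P] (h : MemLp g 2 P) (h0 : ∀ o, 0 ≤ g o) :
    ∫ o, g o ∂P ≤ l2norm P g := by
  have := integral_mul_le_l2norm_mul h (memLp_const (1 : ℝ)) h0 (fun _ => zero_le_one)
  simpa [l2norm] using this

end L2norm

/-! ### Bias of the full influence function -/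

namespace IsRegularModel

variable {P : Measure (Obs p)} [IsProbabilityMeasure P] {η η' : Nuisance p} {c C : ℝ} {N : ℕ}

theorem H_nonneg (h : IsRegularModel P η c C N) (n : ℕ) (a : Fin n → Bool)
    (x : Fin n → Fin p → ℝ) : 0 ≤ η.H n a x := by
  rw [h.H_eq]
  exact measureReal_nonneg

theorem integral_treatCov (h : IsRegularModel P η c C N)
    {F : ∀ n : ℕ, (Fin n → Bool) → (Fin n → Fin p → ℝ) → ℝ} (hF : ∀ n a, Measurable (F n a))
    (hFi : Integrable (fun o : Obs p => F o.1 (treat o) (covar o)) P) :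
    Integrable (fun o : Obs p => ∑ a : Fin o.1 → Bool, η.H o.1 a (covar o) * F o.1 a (covar o)) P ∧
    ∫ o, F o.1 (treat o) (covar o) ∂P =
      ∫ o, ∑ a : Fin o.1 → Bool, η.H o.1 a (covar o) * F o.1 a (covar o) ∂P := by
  rw [h.H_eq]
  exact integrable_and_integral_treatCov P hF hFi

/-- The sum is at most one everywhere, as the mass of disjoint atoms, and its integral is one by
disintegration of the constant function. Hence the nonnegative deficit vanishes almost everywhere.
-/
theorem sum_H_eq_one (h : IsRegularModel P η c C N) :
    ∀ᵐ o ∂P, ∑ a : Fin o.1 → Bool, η.H o.1 a (covar o) = 1 := by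
  have hle : ∀ o : Obs p, ∑ a : Fin o.1 → Bool, η.H o.1 a (covar o) ≤ 1 := by
    intro o
    rw [h.H_eq]
    have hinj : Set.PairwiseDisjoint ((Finset.univ : Finset (Fin o.1 → Bool)) : Set _)
        fun a => ({(⟨o.1, a⟩ : TreatVec)} : Set TreatVec) := by
      intro a _ b _ hab
      simpa [Function.onFun] using hab
    calc ∑ a : Fin o.1 → Bool, treatmentProb P o.1 a (covar o)
        = (condDistrib treatVec cov P (cov o)).real
            (⋃ a ∈ (Finset.univ : Finset (Fin o.1 → Bool)), {(⟨o.1, a⟩ : TreatVec)}) :=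
          (measureReal_biUnion_finset hinj fun _ _ => measurableSet_singleton _).symm
      _ ≤ 1 := measureReal_le_one
  have hkey := h.integral_treatCov (F := fun _ _ _ => 1) (fun _ _ => measurable_const)
    (integrable_const _)
  simp only [mul_one] at hkey
  have h0 : ∫ o, (1 - ∑ a : Fin o.1 → Bool, η.H o.1 a (covar o)) ∂P = 0 := by
    rw [integral_sub (integrable_const _) hkey.1, ← hkey.2, sub_self]
  rw [integral_eq_zero_iff_of_nonneg (fun o => sub_nonneg.2 (hle o))
    ((integrable_const _).sub hkey.1)] at h0
  filter_upwards [h0] with o ho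
  exact (sub_eq_zero.1 ho).symm

theorem memLp_of_le {g : Obs p → ℝ}
    (hg : Measurable[MeasurableSpace.comap treatCov inferInstance] g) (h0 : ∀ o, 0 ≤ g o)
    (hB : ∃ B, ∀ᵐ o ∂P, g o ≤ B) : MemLp g 2 P := by
  obtain ⟨B, hB⟩ := hB
  refine MemLp.of_bound (hg.mono measurable_treatCov.comap_le le_rfl).aestronglyMeasurable B ?_
  filter_upwards [hB] with o ho
  rwa [Real.norm_of_nonneg (h0 o)]

theorem memLp_errH (h : IsRegularModel P η c C N) (h' : IsAdmissible P c C η') :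
    MemLp (errH η' η) 2 P := by
  refine memLp_of_le (measurable_errH h'.meas h.meas) (errH_nonneg _ _) ⟨2 ^ N * 1, ?_⟩
  filter_upwards [h.size, h'.bounded, h.bounded] with o h1 h2 h3
  exact errH_le h1 h.c_pos h2 h3

theorem memLp_errG (h : IsRegularModel P η c C N) (h' : IsAdmissible P c C η') :
    MemLp (errG η' η) 2 P := by
  refine memLp_of_le (measurable_errG h'.meas h.meas) (errG_nonneg _ _) ⟨2 ^ N * (C + C), ?_⟩
  filter_upwards [h.size, h'.bounded, h.bounded] with o h1 h2 h3
  exact errG_le h1 h.C_pos.le h2 h3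

theorem memLp_errPhi (h : IsRegularModel P η c C N) (h' : IsAdmissible P c C η') :
    MemLp (errPhi η' η) 2 P := by
  refine memLp_of_le (measurable_errPhi h'.meas h.meas) (errPhi_nonneg _ _) ⟨2 ^ N * (C + C), ?_⟩
  filter_upwards [h.size, h'.bounded, h.bounded] with o h1 h2 h3
  exact errPhi_le h1 h.C_pos.le h2 h3

theorem memLp_errW (h : IsRegularModel P η c C N) (h' : IsAdmissible P c C η') :
    MemLp (errW η' η) 2 P := by
  refine memLp_of_le (measurable_errW h'.meas h.meas) (errW_nonneg _ _)
    ⟨2 ^ N * (C + C + 2 ^ N * C), ?_⟩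
  filter_upwards [h.size, h'.bounded, h.bounded] with o h1 h2 h3
  exact errW_le h1 h.c_pos h.C_pos.le h2 h3

theorem memLp_condErrPhi (h : IsRegularModel P η c C N) (h' : IsAdmissible P c C η') :
    MemLp (condErrPhi η' η) 2 P := by
  refine memLp_of_le (measurable_condErrPhi h'.meas h.meas)
    (fun o => condErrPhi_nonneg fun a => h.H_nonneg _ _ _) ⟨2 ^ N * (2 ^ N * (C + C)), ?_⟩
  filter_upwards [h.size, h'.bounded, h.bounded] with o h1 h2 h3
  exact condErrPhi_le h1 h.c_pos h.C_pos.le h2 h3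

theorem errWeight_le_ae (h : IsRegularModel P η c C N) :
    ∀ᵐ o ∂P, errWeight η' η o ≤ errW η' η o + condErrPhi η' η o := by
  filter_upwards [h.centered] with o ho
  exact errWeight_le (fun a => h.H_nonneg _ _ _) ho

/-- Conditional averaging contracts `L₂`, so the rate assumed at the observed treatment also
controls the average over treatments. -/
theorem l2norm_condErrPhi_le (h : IsRegularModel P η c C N) (h' : IsAdmissible P c C η') :
    l2norm P (condErrPhi η' η) ≤ l2norm P (errPhi η' η) := by
  refine Real.sqrt_le_sqrt ?_
  have hkey := h.integral_treatCov
    (F := fun n a' x => (∑ a : Fin n → Bool, ‖η'.phi n a' x a - η.phi n a' x a‖) ^ 2)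
    (fun n a' => (Finset.measurable_fun_sum _ fun a _ =>
      ((h'.meas.phi n a' a).sub (h.meas.phi n a' a)).norm).pow_const 2)
    (h.memLp_errPhi h').integrable_sq
  refine (integral_mono_ae (h.memLp_condErrPhi h').integrable_sq hkey.1 ?_).trans hkey.2.ge
  filter_upwards [h.sum_H_eq_one] with o ho
  exact sq_condErrPhi_le (fun a => h.H_nonneg _ _ _) ho

theorem memLp_norm_outcome (h : IsRegularModel P η c C N) :
    MemLp (fun o : Obs p => ‖outcome o‖) 2 P := by
  have hm : Measurable fun o : Obs p => ‖outcome o‖ :=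
    measurable_sigma_iff.2 fun n => measurable_norm.comp measurable_fst
  rw [memLp_two_iff_integrable_sq hm.aestronglyMeasurable]
  have := (integral_norm_outcome_sq_mul_le h.size h.integrable_outcome_sq h.moment
    (g := fun _ => 1) measurable_const (fun _ => zero_le_one) (B := 1)
    (Eventually.of_forall fun _ => le_rfl)).1
  simpa using this

/-- Bias of the uncentered influence function at estimated nuisance functions. -/
theorem integral_uncenteredIF_sub (h : IsRegularModel P η c C N) (h' : IsAdmissible P c C η') :
    Integrable (uncenteredIF η') P ∧ Integrable (condBias η' η) P ∧
    ∫ o, uncenteredIF η' o ∂P - estimand P η.w = ∫ o, condBias η' η o ∂P := by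
  have hc := h.c_pos
  have hC := h.C_pos.le
  have mC : ∀ {g : Obs p → ℝ}, Measurable[MeasurableSpace.comap treatCov inferInstance] g →
      Measurable g := fun hg => hg.mono measurable_treatCov.comap_le le_rfl
  -- the sum of the `hTerm`s
  let F₁ : ∀ n : ℕ, (Fin n → Bool) → (Fin n → Fin p → ℝ) → ℝ := fun n a' x =>
    ∑ a : Fin n → Bool, inner ℝ (η'.w n a x + η'.phi n a' x a) (η'.G n a x)
  have hF₁ : ∀ n a, Measurable (F₁ n a) := fun n a' => Finset.measurable_fun_sum _ fun a _ =>
    ((h'.meas.w n a).add (h'.meas.phi n a' a)).inner (h'.meas.G n a)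
  have hi₁ : Integrable (fun o : Obs p => F₁ o.1 (treat o) (covar o)) P := by
    refine Integrable.of_bound (mC (measurable_comap_treatCov hF₁)).aestronglyMeasurable
      (2 ^ N * (2 * C ^ 2)) ?_
    filter_upwards [h.size, h'.bounded] with o hN ho
    exact (norm_sum_le _ _).trans (sum_treatment_le hN (by positivity) fun a =>
      abs_hTerm_le hC ho a)
  -- the outcome residual
  let v : VecFun p := fun n a x => (η'.H n a x)⁻¹ • η'.w n a x
  have hv : ∀ n a, Measurable (v n a) := fun n a => (h'.meas.H n a).inv.smul (h'.meas.w n a)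
  have hvb : ∀ᵐ o ∂P, ‖v o.1 (treat o) (covar o)‖ ≤ c⁻¹ * C := by
    filter_upwards [h'.bounded] with o ho
    have := (ho.H (treat o)).1
    rw [norm_smul, norm_inv, Real.norm_of_nonneg (hc.trans this).le]
    exact mul_le_mul (inv_anti₀ hc this.le) (ho.w _) (norm_nonneg _) (inv_nonneg.2 hc.le)
  have hres := integral_inner_outcome_sub h.size h.integrable_outcome hv hvb
  rw [← h.G_eq] at hres
  -- the regression residual
  let F₂ : ∀ n : ℕ, (Fin n → Bool) → (Fin n → Fin p → ℝ) → ℝ := fun n a x =>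
    inner ℝ (v n a x) (η.G n a x - η'.G n a x)
  have hF₂ : ∀ n a, Measurable (F₂ n a) := fun n a =>
    (hv n a).inner ((h.meas.G n a).sub (h'.meas.G n a))
  have hi₂ : Integrable (fun o : Obs p => F₂ o.1 (treat o) (covar o)) P := by
    refine Integrable.of_bound (mC (measurable_comap_treatCov hF₂)).aestronglyMeasurable
      (c⁻¹ * C * (C + C)) ?_
    filter_upwards [hvb, h'.bounded, h.bounded] with o h1 h2 h3
    exact (norm_inner_le_norm _ _).trans (mul_le_mul h1
      ((norm_sub_le _ _).trans (add_le_add (h3.G _) (h2.G _))) (norm_nonneg _) (by positivity))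
  -- the estimand
  let F₃ : ∀ n : ℕ, (Fin n → Bool) → (Fin n → Fin p → ℝ) → ℝ := fun n _ x =>
    ∑ a : Fin n → Bool, inner ℝ (η.w n a x) (η.G n a x)
  have hF₃ : ∀ n a, Measurable (F₃ n a) := fun n _ => Finset.measurable_fun_sum _ fun a _ =>
    (h.meas.w n a).inner (h.meas.G n a)
  have hi₃ : Integrable (fun o : Obs p => F₃ o.1 (treat o) (covar o)) P := by
    refine Integrable.of_bound (mC (measurable_comap_treatCov hF₃)).aestronglyMeasurable
      (2 ^ N * (C * C)) ?_
    filter_upwards [h.size, h.bounded] with o hN ho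
    exact (norm_sum_le _ _).trans (sum_treatment_le hN (by positivity) fun a =>
      (norm_inner_le_norm _ _).trans (mul_le_mul (ho.w a) (ho.G a) (norm_nonneg _) hC))
  have hl : Integrable (lTerm η') P := by
    refine Integrable.mono' (g := fun o => C * (‖outcome o‖ + C) / c)
      ((((h.memLp_norm_outcome.integrable one_le_two).add
        (integrable_const C)).const_mul C).div_const c)
      h'.meas.measurable_lTerm.aestronglyMeasurable ?_
    filter_upwards [h'.bounded] with o ho
    exact abs_lTerm_le hc hC ho
  have hleq : ∀ o, lTerm η' o = inner ℝ (v o.1 (treat o) (covar o))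
      (outcome o - η.G o.1 (treat o) (covar o)) + F₂ o.1 (treat o) (covar o) := by
    intro o
    simp only [F₂, v]
    rw [← inner_add_right, sub_add_sub_cancel, real_inner_smul_left, lTerm, div_eq_inv_mul]
  have hi₄ : Integrable (fun o : Obs p => inner ℝ (v o.1 (treat o) (covar o))
      (outcome o - η.G o.1 (treat o) (covar o))) P :=
    (hl.sub hi₂).congr (Eventually.of_forall fun o => by
      simp only [Pi.sub_apply, hleq, add_sub_cancel_right])
  have hlint : ∫ o, lTerm η' o ∂P = ∫ o, F₂ o.1 (treat o) (covar o) ∂P := by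
    simp_rw [hleq]
    rw [integral_add hi₄ hi₂, hres, zero_add]
  have k₁ := h.integral_treatCov hF₁ hi₁
  have k₂ := h.integral_treatCov hF₂ hi₂
  have hest : estimand P η.w = ∫ o, F₃ o.1 (treat o) (covar o) ∂P := by
    rw [estimand, ← h.G_eq]
  refine ⟨hi₁.add hl, (k₁.1.add k₂.1).sub hi₃, ?_⟩
  have e1 : ∫ o, uncenteredIF η' o ∂P =
      ∫ o, F₁ o.1 (treat o) (covar o) ∂P + ∫ o, lTerm η' o ∂P := integral_add hi₁ hl
  have e2 := integral_sub (k₁.1.add k₂.1) hi₃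
  have e3 := integral_add k₁.1 k₂.1
  rw [e1, hlint, hest, k₁.2, k₂.2, ← e3]
  exact e2.symm

/-- The pointwise bound is integrated and Cauchy–Schwarz separates the products, giving exactly the
quantities for which rates are assumed. -/
theorem abs_integral_uncenteredIF_sub_le (h : IsRegularModel P η c C N)
    (h' : IsAdmissible P c C η') :
    |∫ o, uncenteredIF η' o ∂P - estimand P η.w| ≤
      C * l2norm P (errW η' η) +
      C / c * (l2norm P (errH η' η) * l2norm P (errG η' η)) +
      (l2norm P (errW η' η) + l2norm P (errPhi η' η)) * l2norm P (errG η' η) := by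
  have hc := h.c_pos
  have hC := h.C_pos.le
  have hH := h.memLp_errH h'
  have hG := h.memLp_errG h'
  have hW := h.memLp_errW h'
  have hPhi := h.memLp_condErrPhi h'
  have iHG : Integrable (fun o => errH η' η o * errG η' η o) P := hH.integrable_mul hG
  have iWG : Integrable (fun o => errW η' η o * errG η' η o) P := hW.integrable_mul hG
  have iPG : Integrable (fun o => condErrPhi η' η o * errG η' η o) P := hPhi.integrable_mul hG
  have iW : Integrable (errW η' η) P := hW.integrable one_le_two
  rw [(h.integral_uncenteredIF_sub h').2.2]
  refine abs_integral_le_integral_abs.trans ?_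
  have hle : ∀ᵐ o ∂P, |condBias η' η o| ≤ C * errW η' η o + C / c * (errH η' η o * errG η' η o) +
      (errW η' η o * errG η' η o + condErrPhi η' η o * errG η' η o) := by
    filter_upwards [h'.bounded, h.sum_H_eq_one, h.errWeight_le_ae (η' := η')] with o h1 h2 h3
    refine (abs_condBias_le hc hC h1 h2).trans (add_le_add le_rfl ?_)
    rw [← add_mul]
    exact mul_le_mul_of_nonneg_right h3 (errG_nonneg _ _ _)
  refine (integral_mono_ae (h.integral_uncenteredIF_sub h').2.1.abs
    (((iW.const_mul C).add (iHG.const_mul (C / c))).add (iWG.add iPG)) hle).trans ?_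
  have e1 := integral_add ((iW.const_mul C).add (iHG.const_mul (C / c))) (iWG.add iPG)
  have e2 := integral_add (iW.const_mul C) (iHG.const_mul (C / c))
  have e3 := integral_add iWG iPG
  simp only [Pi.add_apply] at e1
  simp only [Pi.add_apply]
  rw [e1, e2, e3, integral_const_mul, integral_const_mul, add_mul]
  have nP : ∀ o, 0 ≤ condErrPhi η' η o := fun o => condErrPhi_nonneg fun a => h.H_nonneg _ _ _
  gcongr
  · exact integral_le_l2norm hW (errW_nonneg _ _)
  · exact integral_mul_le_l2norm_mul hH hG (errH_nonneg _ _) (errG_nonneg _ _)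
  · exact integral_mul_le_l2norm_mul hW hG (errW_nonneg _ _) (errG_nonneg _ _)
  · exact (integral_mul_le_l2norm_mul hPhi hG nP (errG_nonneg _ _)).trans
      (mul_le_mul_of_nonneg_right (h.l2norm_condErrPhi_le h') l2norm_nonneg)

/-- The bias bound applied to the truth itself: `errG` is zero identically, `errW` is zero by
centering, and every term of the bound contains one of them. -/
theorem integral_uncenteredIF (h : IsRegularModel P η c C N) :
    ∫ o, uncenteredIF η o ∂P = estimand P η.w := by
  have hG : errG η η = fun _ => 0 := by ext o; simp [errG]
  have hW : errW η η =ᵐ[P] fun _ => 0 := by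
    filter_upwards [h.centered] with o ho
    simp [errW, ho]
  have hW0 : l2norm P (errW η η) = 0 := by
    have : ∫ o, errW η η o ^ 2 ∂P = ∫ _, (0 : ℝ) ^ 2 ∂P :=
      integral_congr_ae (hW.mono fun o ho => by simp only [ho])
    simp [l2norm, this]
  have hG0 : l2norm P (errG η η) = 0 := by simp [l2norm, hG]
  have := h.abs_integral_uncenteredIF_sub_le h.toIsAdmissible
  rw [hW0, hG0] at this
  simpa [sub_eq_zero] using this

end IsRegularModel

/-! ### First two moments of an average of independent draws -/

section Draws

variable {α : Type*} [Fintype α] [MeasurableSpace α] [MeasurableSingletonClass α]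
  {ν : Measure α} [IsProbabilityMeasure ν]

theorem integral_average_add_const (hr : 0 < r) (g : α → ℝ) (l : ℝ) :
    ∫ A : Fin r → α, ((1 / (r : ℝ)) * ∑ q, g (A q) + l) ∂(Measure.pi fun _ => ν) =
      ∫ a, g a ∂ν + l := by
  have hr' : (r : ℝ) ≠ 0 := by positivity
  have hi : ∀ q : Fin r, ∫ A : Fin r → α, g (A q) ∂(Measure.pi fun _ => ν) = ∫ a, g a ∂ν :=
    fun q => integral_comp_eval (μ := fun _ : Fin r => ν)
      (Measurable.of_discrete (f := g)).aestronglyMeasurable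
  rw [integral_add Integrable.of_finite (integrable_const _), integral_const_mul,
    integral_finsetSum _ fun _ _ => Integrable.of_finite]
  simp only [hi]
  simp [hr']

/-- Squared mean plus variance. Applied conditionally on a cluster, with `l` carrying both `lTerm`
and the centering. -/
theorem integral_sq_average_add_const (hr : 0 < r) (g : α → ℝ) (l : ℝ) :
    ∫ A : Fin r → α, ((1 / (r : ℝ)) * ∑ q, g (A q) + l) ^ 2 ∂(Measure.pi fun _ => ν) =
      (∫ a, g a ∂ν + l) ^ 2 + (1 / (r : ℝ)) * variance g ν := by
  have hr' : (r : ℝ) ≠ 0 := by positivity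
  have hm : MemLp (fun A : Fin r → α => (1 / (r : ℝ)) * ∑ q, g (A q) + l) 2
      (Measure.pi fun _ => ν) := MemLp.of_discrete
  have hv := variance_eq_sub hm
  rw [variance_add_const (Measurable.of_discrete).aestronglyMeasurable, variance_const_mul,
    integral_average_add_const hr] at hv
  have hs := variance_sum_pi (μ := fun _ : Fin r => ν) (X := fun _ => g)
    fun _ => MemLp.of_discrete
  have hs' : variance (fun A : Fin r → α => ∑ q, g (A q)) (Measure.pi fun _ => ν) =
      r * variance g ν := by
    rw [← Finset.sum_fn, hs]
    simp
  rw [hs'] at hv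
  simp only [Pi.pow_apply] at hv
  have e : (1 / (r : ℝ)) ^ 2 * (r * variance g ν) = (1 / (r : ℝ)) * variance g ν := by
    field_simp
  linarith

end Draws

/-! ### Bounds on the approximated influence function -/

section Bounds

variable {f : ∀ n : ℕ, PMF (Fin n → Bool)}

/-- There are only finitely many treatment vectors of length at most `N`; the sum of all the
inverses dominates each of them, and the added one makes it visibly positive. -/
theorem exists_inv_pmf_le (f : ∀ n : ℕ, PMF (Fin n → Bool)) (N : ℕ) :
    ∃ B : ℝ, 0 < B ∧ ∀ n ≤ N, ∀ a, ((f n a).toReal)⁻¹ ≤ B := by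
  have h0 : ∀ n a, 0 ≤ ((f n a).toReal)⁻¹ := fun n a => inv_nonneg.2 ENNReal.toReal_nonneg
  have h1 : ∀ n, 0 ≤ ∑ a, ((f n a).toReal)⁻¹ := fun n => Finset.sum_nonneg fun a _ => h0 n a
  have h2 : 0 ≤ ∑ n ∈ Finset.range (N + 1), ∑ a, ((f n a).toReal)⁻¹ :=
    Finset.sum_nonneg fun n _ => h1 n
  refine ⟨∑ n ∈ Finset.range (N + 1), ∑ a, ((f n a).toReal)⁻¹ + 1, by linarith,
    fun n hn a => ?_⟩
  have h3 := Finset.single_le_sum (f := fun a => ((f n a).toReal)⁻¹) (fun a _ => h0 n a)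
    (Finset.mem_univ a)
  have h4 := Finset.single_le_sum (f := fun n => ∑ a, ((f n a).toReal)⁻¹) (fun n _ => h1 n)
    (Finset.mem_range.2 (Nat.lt_succ_of_le hn))
  linarith

theorem abs_average_le {B : ℝ} (hB : 0 ≤ B) {x : Fin r → ℝ} (hx : ∀ q, |x q| ≤ B) :
    |(1 / (r : ℝ)) * ∑ q, x q| ≤ B := by
  rw [abs_mul, abs_of_nonneg (by positivity)]
  have : |∑ q, x q| ≤ r * B := by
    refine (Finset.abs_sum_le_sum_abs _ _).trans ((Finset.sum_le_card_nsmul _ _ B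
      fun q _ => hx q).trans ?_)
    simp
  rcases Nat.eq_zero_or_pos r with rfl | hr
  · simpa using hB
  · have hr' : (0 : ℝ) < r := by positivity
    rw [one_div, inv_mul_le_iff₀ hr']
    exact this

theorem abs_div_pmf_le {n : ℕ} {B x M : ℝ} {a : Fin n → Bool} (hB : ((f n a).toReal)⁻¹ ≤ B)
    (hx : |x| ≤ M) : |x / (f n a).toReal| ≤ B * M := by
  rw [abs_div, abs_of_nonneg (ENNReal.toReal_nonneg (a := f n a)), div_eq_inv_mul]
  exact mul_le_mul hB hx (abs_nonneg _) ((inv_nonneg.2 ENNReal.toReal_nonneg).trans hB)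

variable {η η' : Nuisance p} {c C B : ℝ} {z : AugObs p r}

theorem abs_approxIF_le (hc : 0 < c) (hC : 0 ≤ C) (hB0 : 0 ≤ B)
    (hB : ∀ a, ((f z.1 a).toReal)⁻¹ ≤ B) (h : η.BoundedAt c C z.obs) :
    |approxIF f η z| ≤ B * (2 * C ^ 2) + C * C / c + C / c * ‖outcome z.obs‖ := by
  refine (abs_add_le _ _).trans ((add_le_add (abs_average_le (by positivity) fun q =>
    abs_div_pmf_le (hB _) (abs_hTerm_le hC h _)) (abs_lTerm_le hc hC h)).trans (le_of_eq ?_))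
  ring

/-- The four summands of the constant come from the sampled `hTerm`s and from the three telescoping
pieces of `lTerm`. The factor `1 + ‖outcome z.obs‖` is kept apart, since the outcome has only moment
bounds. -/
theorem abs_approxIF_sub_le (hc : 0 < c) (hC : 0 ≤ C) (hB0 : 0 ≤ B)
    (hB : ∀ a, ((f z.1 a).toReal)⁻¹ ≤ B) (h' : η'.BoundedAt c C z.obs)
    (h : η.BoundedAt c C z.obs) :
    |approxIF f η' z - approxIF f η z| ≤
      (2 * B * C + (1 + C) / c + C / c + C * (1 + C) / c ^ 2) * (1 + ‖outcome z.obs‖) *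
      (errWeight η' η z.obs + errPhi η' η z.obs + errG η' η z.obs + errH η' η z.obs) := by
  have n1 := errWeight_nonneg η' η z.obs
  have n2 := errPhi_nonneg η' η z.obs
  have n3 := errG_nonneg η' η z.obs
  have n4 := errH_nonneg η' η z.obs
  have heq : approxIF f η' z - approxIF f η z = (1 / (r : ℝ)) * ∑ q : Fin r,
      (hTerm η' z.obs (z.draw q) - hTerm η z.obs (z.draw q)) / (f z.1 (z.draw q)).toReal +
      (lTerm η' z.obs - lTerm η z.obs) := by
    simp only [approxIF, sub_div, Finset.sum_sub_distrib]
    ring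
  rw [heq]
  refine (abs_add_le _ _).trans ((add_le_add (abs_average_le (by positivity) fun q =>
    abs_div_pmf_le (hB _) (abs_hTerm_sub_le hC h' h _)) (abs_lTerm_sub_le hc hC h' h)).trans ?_)
  set e1 := errWeight η' η z.obs
  set e2 := errPhi η' η z.obs
  set e3 := errG η' η z.obs
  set e4 := errH η' η z.obs
  set y := ‖outcome z.obs‖
  have hy : 0 ≤ y := norm_nonneg _
  have t1 : B * (C * (e1 + e2) + 2 * C * e3) ≤ 2 * B * C * (1 + y) * (e1 + e2 + e3 + e4) := by
    have : B * (C * (e1 + e2) + 2 * C * e3) ≤ 2 * B * C * 1 * (e1 + e2 + e3 + e4) := by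
      have : 0 ≤ B * C * (e1 + e2 + 2 * e4) := by positivity
      linarith
    refine this.trans ?_
    gcongr
    linarith
  have t2 : (y + C) / c * e1 ≤ (1 + C) / c * (1 + y) * (e1 + e2 + e3 + e4) := by
    refine mul_le_mul ?_ (by linarith) n1 (by positivity)
    rw [div_mul_eq_mul_div]
    gcongr
    nlinarith [mul_nonneg hC hy]
  have t3 : C / c * e3 ≤ C / c * (1 + y) * (e1 + e2 + e3 + e4) := by
    refine mul_le_mul ?_ (by linarith) n3 (by positivity)
    exact le_mul_of_one_le_right (by positivity) (by linarith)
  have t4 : C * (y + C) / c ^ 2 * e4 ≤ C * (1 + C) / c ^ 2 * (1 + y) * (e1 + e2 + e3 + e4) := by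
    refine mul_le_mul ?_ (by linarith) n4 (by positivity)
    rw [div_mul_eq_mul_div, mul_assoc]
    gcongr
    nlinarith [mul_nonneg hC hy]
  linarith

end Bounds

/-! ### Moments and `L₂` continuity of the approximated influence function -/

namespace IsRegularModel

variable {P : Measure (Obs p)} [IsProbabilityMeasure P] {η η' : Nuisance p} {c C : ℝ} {N : ℕ}
  {f : ∀ n : ℕ, PMF (Fin n → Bool)}

theorem measurePreserving_obs (P : Measure (Obs p)) [IsProbabilityMeasure P]
    (f : ∀ n : ℕ, PMF (Fin n → Bool)) :
    MeasurePreserving (AugObs.obs : AugObs p r → Obs p) (augLaw P f r) P :=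
  ⟨measurable_obs, map_obs_augLaw P f⟩

theorem memLp_affine {α : Type*} [MeasurableSpace α] {ν : Measure α} [IsFiniteMeasure ν]
    {Y : α → ℝ} (hY : MemLp Y 2 ν) (a b : ℝ) : MemLp (fun o => a + b * Y o) 2 ν :=
  (memLp_const a).add (hY.const_mul b)

theorem memLp_approxIF (h : IsRegularModel P η c C N) (h' : IsAdmissible P c C η') :
    MemLp (approxIF f η' : AugObs p r → ℝ) 2 (augLaw P f r) := by
  obtain ⟨B, hB0, hB⟩ := exists_inv_pmf_le f N
  have hYz : MemLp (fun z : AugObs p r => B * (2 * C ^ 2) + C * C / c + C / c * ‖outcome z.obs‖) 2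
      (augLaw P f r) :=
    (memLp_affine h.memLp_norm_outcome _ _).comp_measurePreserving (measurePreserving_obs P f)
  refine hYz.mono'
    (h'.meas.measurable_approxIF f).aestronglyMeasurable ?_
  filter_upwards [ae_augLaw_obs f h.size, ae_augLaw_obs f h'.bounded] with z h1 h2
  exact abs_approxIF_le h.c_pos h.C_pos.le hB0.le (hB _ h1) h2

theorem pmf_toReal_pos (hf : ∀ n a, 0 < f n a) (n : ℕ) (a : Fin n → Bool) :
    0 < (f n a).toReal := ENNReal.toReal_pos (hf n a).ne' ((f n).apply_ne_top a)

/-- Importance weighting: the division cancels the sampling probability, which is positive at every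
vector. -/
theorem integral_hTerm_div (hf : ∀ n a, 0 < f n a) (o : Obs p) :
    ∫ a : Fin o.1 → Bool, hTerm η' o a / (f o.1 a).toReal ∂(f o.1).toMeasure =
      ∑ a : Fin o.1 → Bool, hTerm η' o a := by
  rw [PMF.integral_eq_sum]
  refine Finset.sum_congr rfl fun a _ => ?_
  rw [smul_eq_mul, mul_div_cancel₀ _ (pmf_toReal_pos hf _ a).ne']

theorem integral_approxIF (hr : 0 < r) (hf : ∀ n a, 0 < f n a) (h : IsRegularModel P η c C N)
    (h' : IsAdmissible P c C η') :
    ∫ z : AugObs p r, approxIF f η' z ∂(augLaw P f r) = ∫ o, uncenteredIF η' o ∂P := by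
  rw [(integral_augLaw P f (h'.meas.measurable_approxIF f)
    ((h.memLp_approxIF h').integrable one_le_two)).2]
  refine integral_congr_ae (Eventually.of_forall fun o => ?_)
  have := integral_average_add_const (ν := (f o.1).toMeasure) hr
    (fun a => hTerm η' o a / (f o.1 a).toReal) (lTerm η' o)
  rw [integral_hTerm_div hf] at this
  exact this

/-- Law of total variance given the cluster: integrate out the draws first, then the cluster. -/
theorem variance_approxIF (hr : 0 < r) (hf : ∀ n a, 0 < f n a) (h : IsRegularModel P η c C N) :
    variance (approxIF f η : AugObs p r → ℝ) (augLaw P f r) =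
      ∫ o, (uncenteredIF η o - estimand P η.w) ^ 2 ∂P + (1 / (r : ℝ)) * meanCondVar P f η := by
  have hm := h.meas.measurable_approxIF (r := r) f
  have hL := h.memLp_approxIF (r := r) (f := f) h.toIsAdmissible
  have hmean : ∫ z : AugObs p r, approxIF f η z ∂(augLaw P f r) = estimand P η.w := by
    rw [h.integral_approxIF hr hf h.toIsAdmissible, h.integral_uncenteredIF]
  set Ψ := estimand P η.w
  rw [variance_eq_integral hm.aemeasurable, hmean]
  have hsq : Integrable (fun z : AugObs p r => (approxIF f η z - Ψ) ^ 2) (augLaw P f r) :=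
    (hL.sub (memLp_const Ψ)).integrable_sq
  have hkey := integral_augLaw P f ((hm.sub_const Ψ).pow_const 2) hsq
  have hinner : ∀ o : Obs p, ∫ A : Fin r → Fin o.1 → Bool,
      (approxIF f η (⟨o.1, o.2, A⟩ : AugObs p r) - Ψ) ^ 2
        ∂(Measure.pi fun _ => (f o.1).toMeasure) =
      (uncenteredIF η o - Ψ) ^ 2 + (1 / (r : ℝ)) *
        variance (fun a : Fin o.1 → Bool => hTerm η o a / (f o.1 a).toReal)
          (f o.1).toMeasure := by
    intro o
    have := integral_sq_average_add_const (ν := (f o.1).toMeasure) hr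
      (fun a => hTerm η o a / (f o.1 a).toReal) (lTerm η o - Ψ)
    rw [integral_hTerm_div hf, ← add_sub_assoc] at this
    rw [uncenteredIF, ← this]
    refine integral_congr_ae (Eventually.of_forall fun A => ?_)
    change (_ + lTerm η o - Ψ) ^ 2 = (_ + (lTerm η o - Ψ)) ^ 2
    rw [← add_sub_assoc]
    rfl
  -- The square is dominated by the integral over the draws, which exceeds it by a nonnegative
  -- variance; so integrability is inherited from the approximated influence function.
  have hu : Integrable (fun o => (uncenteredIF η o - Ψ) ^ 2) P := by
    refine Integrable.mono' hkey.1 ?_ (Eventually.of_forall fun o => ?_)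
    · exact (((h.integral_uncenteredIF_sub h.toIsAdmissible).1.1.sub
        aestronglyMeasurable_const).pow 2)
    · simp only [hinner]
      rw [Real.norm_of_nonneg (sq_nonneg _)]
      have := variance_nonneg (fun a : Fin o.1 → Bool => hTerm η o a / (f o.1 a).toReal)
          (f o.1).toMeasure
      exact le_add_of_nonneg_right (by positivity)
  have hi := hkey.1
  rw [hkey.2]
  simp only [hinner] at hi ⊢
  have hv := hi.sub hu
  rw [integral_add hu, integral_const_mul, meanCondVar]
  refine hv.congr (Eventually.of_forall fun o => ?_)
  simp

set_option maxHeartbeats 1000000 in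
-- The constant is uniform over admissible `η'`, which is what allows the bound to be used at
-- random, fitted nuisance functions.
theorem integral_sq_approxIF_sub_le (h : IsRegularModel P η c C N)
    (f : ∀ n : ℕ, PMF (Fin n → Bool)) (r : ℕ) :
    ∃ M : ℝ, 0 ≤ M ∧ ∀ η' : Nuisance p, IsAdmissible P c C η' →
      ∫ z : AugObs p r, (approxIF f η' z - approxIF f η z) ^ 2 ∂(augLaw P f r) ≤
        M * (l2norm P (errH η' η) ^ 2 + l2norm P (errG η' η) ^ 2 +
          l2norm P (errPhi η' η) ^ 2 + l2norm P (errW η' η) ^ 2) := by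
  obtain ⟨B, hB0, hB⟩ := exists_inv_pmf_le f N
  have hc := h.c_pos
  have hC := h.C_pos.le
  set K := 2 * B * C + (1 + C) / c + C / c + C * (1 + C) / c ^ 2 with hK
  have hK0 : 0 ≤ K := by positivity
  -- `2 * K ^ 2` comes from `(1 + y)² ≤ 2 (1 + y²)`, `1 + N * C` from the conditional second
  -- moments, and `10 = 5 · 2` from squaring a sum of five errors and then merging `condErrPhi` with
  -- `errPhi`.
  refine ⟨2 * K ^ 2 * (1 + N * C) * 10, by positivity, fun η' h' => ?_⟩
  let g : Obs p → ℝ := fun o => (errW η' η o + condErrPhi η' η o + errPhi η' η o +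
    errG η' η o + errH η' η o) ^ 2
  have nP : ∀ o, 0 ≤ condErrPhi η' η o := fun o => condErrPhi_nonneg fun a => h.H_nonneg _ _ _
  have hg : Measurable[MeasurableSpace.comap treatCov inferInstance] g :=
    (((((measurable_errW h'.meas h.meas).add (measurable_condErrPhi h'.meas h.meas)).add
      (measurable_errPhi h'.meas h.meas)).add (measurable_errG h'.meas h.meas)).add
      (measurable_errH h'.meas h.meas)).pow_const 2
  have hgi : Integrable g P := (((((h.memLp_errW h').add (h.memLp_condErrPhi h')).add
    (h.memLp_errPhi h')).add (h.memLp_errG h')).add (h.memLp_errH h')).integrable_sq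
  have hgb : ∀ᵐ o ∂P, g o ≤ (2 ^ N * (C + C + 2 ^ N * C) + 2 ^ N * (2 ^ N * (C + C)) +
      2 ^ N * (C + C) + 2 ^ N * (C + C) + 2 ^ N * 1) ^ 2 := by
    filter_upwards [h.size, h'.bounded, h.bounded] with o h1 h2 h3
    have n1 := errW_nonneg η' η o
    have n2 := errPhi_nonneg η' η o
    have n3 := errG_nonneg η' η o
    have n4 := errH_nonneg η' η o
    have n5 := nP o
    refine pow_le_pow_left₀ (by positivity) ?_ 2
    gcongr
    · exact errW_le h1 hc hC h2 h3
    · exact condErrPhi_le h1 hc hC h2 h3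
    · exact errPhi_le h1 hC h2 h3
    · exact errG_le h1 hC h2 h3
    · exact errH_le h1 hc h2 h3
  obtain ⟨hYi, hY⟩ := integral_norm_outcome_sq_mul_le h.size h.integrable_outcome_sq h.moment hg
    (fun o => sq_nonneg _) hgb
  have hGi : Integrable (fun o => 2 * K ^ 2 * (g o + ‖outcome o‖ ^ 2 * g o)) P :=
    (hgi.add hYi).const_mul _
  have step1 : ∫ z : AugObs p r, (approxIF f η' z - approxIF f η z) ^ 2 ∂(augLaw P f r) ≤
      ∫ z : AugObs p r, 2 * K ^ 2 * (g z.obs + ‖outcome z.obs‖ ^ 2 * g z.obs)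
        ∂(augLaw P f r) := by
    have hGz := (measurePreserving_obs (r := r) P f).integrable_comp_of_integrable hGi
    have hdz := ((h.memLp_approxIF (r := r) (f := f) h').sub
      (h.memLp_approxIF (r := r) (f := f) h.toIsAdmissible)).integrable_sq
    refine integral_mono_ae hdz hGz ?_
    filter_upwards [ae_augLaw_obs f h.size, ae_augLaw_obs f h'.bounded, ae_augLaw_obs f h.bounded,
      ae_augLaw_obs f (h.errWeight_le_ae (η' := η'))] with z h1 h2 h3 h4
    have hd := abs_approxIF_sub_le hc hC hB0.le (hB _ h1) h2 h3
    have n2 := errPhi_nonneg η' η z.obs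
    have n3 := errG_nonneg η' η z.obs
    have n4 := errH_nonneg η' η z.obs
    have n5 := nP z.obs
    have n6 := errW_nonneg η' η z.obs
    have n7 : 0 ≤ ‖outcome z.obs‖ := norm_nonneg _
    set S := errW η' η z.obs + condErrPhi η' η z.obs + errPhi η' η z.obs +
      errG η' η z.obs + errH η' η z.obs with hS
    have hS0 : 0 ≤ S := by positivity
    have hd' : |approxIF f η' z - approxIF f η z| ≤ K * (1 + ‖outcome z.obs‖) * S := by
      refine hd.trans ?_
      gcongr
      rw [hS]
      linarith
    have hsq : (1 + ‖outcome z.obs‖) ^ 2 ≤ 2 * (1 + ‖outcome z.obs‖ ^ 2) := by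
      nlinarith [sq_nonneg (1 - ‖outcome z.obs‖)]
    calc (approxIF f η' z - approxIF f η z) ^ 2
        = |approxIF f η' z - approxIF f η z| ^ 2 := (sq_abs _).symm
      _ ≤ (K * (1 + ‖outcome z.obs‖) * S) ^ 2 := pow_le_pow_left₀ (abs_nonneg _) hd' 2
      _ = K ^ 2 * (1 + ‖outcome z.obs‖) ^ 2 * S ^ 2 := by ring
      _ ≤ K ^ 2 * (2 * (1 + ‖outcome z.obs‖ ^ 2)) * S ^ 2 := by gcongr
      _ = 2 * K ^ 2 * (g z.obs + ‖outcome z.obs‖ ^ 2 * g z.obs) := by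
        change _ = 2 * K ^ 2 * (S ^ 2 + ‖outcome z.obs‖ ^ 2 * S ^ 2)
        ring
  have step2 : ∫ z : AugObs p r, 2 * K ^ 2 * (g z.obs + ‖outcome z.obs‖ ^ 2 * g z.obs)
      ∂(augLaw P f r) = ∫ o, 2 * K ^ 2 * (g o + ‖outcome o‖ ^ 2 * g o) ∂P := by
    conv_rhs => rw [← map_obs_augLaw (r := r) P f]
    rw [integral_map measurable_obs.aemeasurable]
    rw [map_obs_augLaw]
    exact hGi.aestronglyMeasurable
  have step3 : ∫ o, g o ∂P ≤ 10 * (l2norm P (errH η' η) ^ 2 + l2norm P (errG η' η) ^ 2 +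
      l2norm P (errPhi η' η) ^ 2 + l2norm P (errW η' η) ^ 2) := by
    have i1 := (h.memLp_errW h').integrable_sq
    have i2 := (h.memLp_condErrPhi h').integrable_sq
    have i3 := (h.memLp_errPhi h').integrable_sq
    have i4 := (h.memLp_errG h').integrable_sq
    have i5 := (h.memLp_errH h').integrable_sq
    have hle : ∫ o, g o ∂P ≤ ∫ o, 5 * (errW η' η o ^ 2 + condErrPhi η' η o ^ 2 +
        errPhi η' η o ^ 2 + errG η' η o ^ 2 + errH η' η o ^ 2) ∂P := by
      refine integral_mono hgi (((((i1.add i2).add i3).add i4).add i5).const_mul 5) fun o => ?_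
      have := sq_sum_le_card_mul_sum_sq (s := (Finset.univ : Finset (Fin 5)))
        (f := ![errW η' η o, condErrPhi η' η o, errPhi η' η o, errG η' η o, errH η' η o])
      simpa [Fin.sum_univ_five, g] using this
    have e1 : ∫ o, (errW η' η o ^ 2 + condErrPhi η' η o ^ 2 +
        errPhi η' η o ^ 2 + errG η' η o ^ 2 + errH η' η o ^ 2) ∂P =
        l2norm P (errW η' η) ^ 2 + l2norm P (condErrPhi η' η) ^ 2 + l2norm P (errPhi η' η) ^ 2 +
        l2norm P (errG η' η) ^ 2 + l2norm P (errH η' η) ^ 2 := by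
      simp only [l2norm_sq]
      have a1 := integral_add i1 i2
      have a2 := integral_add (i1.add i2) i3
      have a3 := integral_add ((i1.add i2).add i3) i4
      have a4 := integral_add (((i1.add i2).add i3).add i4) i5
      simp only [Pi.add_apply] at a2 a3 a4
      rw [a4, a3, a2, a1]
    rw [integral_const_mul, e1] at hle
    have hphi := pow_le_pow_left₀ l2norm_nonneg (h.l2norm_condErrPhi_le h') 2
    have := sq_nonneg (l2norm P (errW η' η))
    have := sq_nonneg (l2norm P (errG η' η))
    have := sq_nonneg (l2norm P (errH η' η))
    linarith
  have hg0 : 0 ≤ ∫ o, g o ∂P := integral_nonneg fun _ => sq_nonneg _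
  refine step1.trans ?_
  rw [step2, integral_const_mul, integral_add hgi hYi]
  calc 2 * K ^ 2 * (∫ o, g o ∂P + ∫ o, ‖outcome o‖ ^ 2 * g o ∂P)
      ≤ 2 * K ^ 2 * (∫ o, g o ∂P + N * C * ∫ o, g o ∂P) := by gcongr
    _ = 2 * K ^ 2 * (1 + N * C) * ∫ o, g o ∂P := by ring
    _ ≤ 2 * K ^ 2 * (1 + N * C) * (10 * _) := by gcongr
    _ = _ := by ring

end IsRegularModel

/-! ### Calculus of stochastic orders -/

section StochasticOrder

variable {Ω : Type*} [MeasurableSpace Ω] {μ : Measure Ω}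
  {X Y : ℕ → Ω → ℝ} {ρ τ : ℕ → ℝ}

/-- `X_m = o_ℙ(1)` as `m → ∞`. -/
def IsLittleOP {Ω : Type*} [MeasurableSpace Ω] (μ : Measure Ω) (X : ℕ → Ω → ℝ) : Prop :=
  ∀ δ : ℝ, 0 < δ → Tendsto (fun m => μ.real {ω | δ ≤ |X m ω|}) atTop (𝓝 0)

theorem IsLittleOP.mono [IsFiniteMeasure μ] (h : IsLittleOP μ Y)
    (hle : ∀ᶠ m in atTop, ∀ᵐ ω ∂μ, |X m ω| ≤ |Y m ω|) :
    IsLittleOP μ X := by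
  intro δ hδ
  refine squeeze_zero' (Eventually.of_forall fun m => measureReal_nonneg) ?_ (h δ hδ)
  filter_upwards [hle] with m hm
  refine ENNReal.toReal_mono (measure_ne_top _ _) (measure_mono_ae ?_)
  filter_upwards [hm] with ω hω h1
  exact le_trans h1 hω

theorem IsLittleOP.add [IsFiniteMeasure μ] (hX : IsLittleOP μ X) (hY : IsLittleOP μ Y) :
    IsLittleOP μ fun m ω => X m ω + Y m ω := by
  intro δ hδ
  have h := (hX (δ / 2) (half_pos hδ)).add (hY (δ / 2) (half_pos hδ))
  rw [add_zero] at h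
  refine squeeze_zero (fun m => measureReal_nonneg) (fun m => ?_) h
  refine (measureReal_mono fun ω hω => ?_).trans (measureReal_union_le _ _)
  by_contra hcon
  simp only [Set.mem_union, Set.mem_ofPred_eq, not_or, not_le] at hcon hω
  have := abs_add_le (X m ω) (Y m ω)
  linarith [hcon.1, hcon.2]

theorem isLittleOP_zero : IsLittleOP μ fun _ _ => 0 := by
  intro δ hδ
  simp [hδ.not_ge]

theorem isLittleOP_sum {ι : Type*} [IsFiniteMeasure μ] (s : Finset ι) {X : ι → ℕ → Ω → ℝ}
    (h : ∀ i ∈ s, IsLittleOP μ (X i)) : IsLittleOP μ fun m ω => ∑ i ∈ s, X i m ω := by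
  classical
  induction s using Finset.induction_on with
  | empty => simpa using isLittleOP_zero
  | insert i s hi ih =>
    simp only [Finset.sum_insert hi]
    exact (h i (Finset.mem_insert_self i s)).add
      (ih fun j hj => h j (Finset.mem_insert_of_mem hj))

theorem IsLittleOP.const_mul (hX : IsLittleOP μ X) (c : ℝ) :
    IsLittleOP μ fun m ω => c * X m ω := by
  rcases eq_or_ne c 0 with rfl | hc
  · simpa using isLittleOP_zero
  · intro δ hδ
    have hc' : 0 < |c| := abs_pos.2 hc
    refine (hX (δ / |c|) (div_pos hδ hc')).congr fun m => ?_
    congr 1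
    ext ω
    simp only [Set.mem_ofPred_eq, abs_mul]
    rw [div_le_iff₀' hc']

theorem IsLittleOP.sq (hX : IsLittleOP μ X) : IsLittleOP μ fun m ω => X m ω ^ 2 := by
  intro δ hδ
  refine (hX (Real.sqrt δ) (Real.sqrt_pos.2 hδ)).congr fun m => ?_
  congr 1
  ext ω
  simp only [Set.mem_ofPred_eq, abs_pow]
  rw [Real.sqrt_le_left (abs_nonneg _)]

theorem isLittleOP_of_tendsto {c : ℕ → ℝ} (h : Tendsto c atTop (𝓝 0)) :
    IsLittleOP μ fun m _ => c m := by
  intro δ hδ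
  refine tendsto_const_nhds.congr' ?_
  filter_upwards [(tendsto_order.1 h.abs).2 δ (by simpa using hδ)] with m hm
  simp [hm.not_ge]

/-- The definition allows a negative constant; a nonnegative one is needed for multiplying two
bounds. -/
theorem isBigOP_exists_nonneg [IsFiniteMeasure μ] (h : IsBigOP μ X ρ) (hρ : ∀ m, 0 ≤ ρ m)
    {δ : ℝ} (hδ : 0 < δ) :
    ∃ M : ℝ, 0 ≤ M ∧ ∀ᶠ m in atTop, μ.real {ω | M * ρ m < |X m ω|} ≤ δ := by
  obtain ⟨M, hM⟩ := h δ hδ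
  refine ⟨max M 0, le_max_right _ _, hM.mono fun m hm => (measureReal_mono fun ω hω => ?_).trans hm⟩
  exact lt_of_le_of_lt (mul_le_mul_of_nonneg_right (le_max_left _ _) (hρ m)) hω

theorem IsBigOP.mul [IsFiniteMeasure μ] (hX : IsBigOP μ X ρ) (hY : IsBigOP μ Y τ)
    (hρ : ∀ m, 0 ≤ ρ m)
    (hτ : ∀ m, 0 ≤ τ m) : IsBigOP μ (fun m ω => X m ω * Y m ω) fun m => ρ m * τ m := by
  intro δ hδ
  obtain ⟨M₁, h₁, hX'⟩ := isBigOP_exists_nonneg hX hρ (half_pos hδ)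
  obtain ⟨M₂, h₂, hY'⟩ := isBigOP_exists_nonneg hY hτ (half_pos hδ)
  refine ⟨M₁ * M₂, ?_⟩
  filter_upwards [hX', hY'] with m h3 h4
  refine ((measureReal_mono fun ω hω => ?_).trans (measureReal_union_le _ _)).trans
    ((add_le_add h3 h4).trans (add_halves δ).le)
  by_contra hcon
  simp only [Set.mem_union, Set.mem_ofPred_eq, not_or, not_lt, abs_mul] at hcon hω
  have := mul_le_mul hcon.1 hcon.2 (abs_nonneg _) (mul_nonneg h₁ (hρ m))
  linarith

theorem IsBigOP.isLittleOP [IsFiniteMeasure μ] (hX : IsBigOP μ X ρ) (hρ : ∀ m, 0 ≤ ρ m) {ν : ℕ → ℝ}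
    (hν : ∀ m, 0 ≤ ν m) (h0 : Tendsto (fun m => ν m * ρ m) atTop (𝓝 0)) :
    IsLittleOP μ fun m ω => ν m * X m ω := by
  intro δ hδ
  refine tendsto_order.2 ⟨fun a ha => Eventually.of_forall fun m =>
    ha.trans_le measureReal_nonneg, fun a ha => ?_⟩
  obtain ⟨M, hM0, hM⟩ := isBigOP_exists_nonneg hX hρ (half_pos ha)
  have h1 : Tendsto (fun m => M * (ν m * ρ m)) atTop (𝓝 0) := by simpa using h0.const_mul M
  filter_upwards [hM, (tendsto_order.1 h1).2 δ hδ] with m h2 h3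
  refine lt_of_le_of_lt ((measureReal_mono fun ω hω => ?_).trans h2) (half_lt_self ha)
  by_contra hcon
  simp only [Set.mem_ofPred_eq, not_lt, abs_mul, abs_of_nonneg (hν m)] at hcon hω
  have := mul_le_mul_of_nonneg_left hcon (hν m)
  linarith

end StochasticOrder

/-! ### Chebyshev's inequality given independent training data -/

section ConditionalChebyshev

variable {Ω 𝒲 𝒵 ι : Type*} [MeasurableSpace Ω] [MeasurableSpace 𝒲] [MeasurableSpace 𝒵] [Fintype ι]
  {μ : Measure Ω} {Q : Measure 𝒵}

/-- A bound on the Lebesgue integral carries integrability with it, whereas a Bochner integral could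
be small merely because it is undefined. Good training data are therefore described by the former.
-/
theorem memLp_two_of_lintegral_le {g : 𝒵 → ℝ} (hg : Measurable g) {ε : ℝ} (hε : 0 ≤ ε)
    (h : ∫⁻ z, ‖g z‖ₑ ^ 2 ∂Q ≤ ENNReal.ofReal ε) :
    MemLp g 2 Q ∧ ∫ z, g z ^ 2 ∂Q ≤ ε := by
  have heq : ∀ z, ‖g z ^ 2‖ₑ = ‖g z‖ₑ ^ 2 := fun z => enorm_pow _ _
  have hi : Integrable (fun z => g z ^ 2) Q := by
    refine ⟨(hg.pow_const 2).aestronglyMeasurable, ?_⟩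
    simp only [HasFiniteIntegral, heq]
    exact h.trans_lt ENNReal.ofReal_lt_top
  refine ⟨(memLp_two_iff_integrable_sq hg.aestronglyMeasurable).2 hi, ?_⟩
  rw [integral_eq_lintegral_of_nonneg_ae (Eventually.of_forall fun _ => sq_nonneg _)
    hi.aestronglyMeasurable]
  refine ENNReal.toReal_le_of_le_ofReal hε (le_trans (le_of_eq ?_) h)
  refine lintegral_congr fun z => ?_
  rw [← heq, Real.enorm_eq_ofReal (sq_nonneg _)]

/-- Chebyshev's inequality for a sum of independent summands, on a product space. -/
theorem measure_pi_abs_sum_sub_le [IsProbabilityMeasure Q] {g : 𝒵 → ℝ} (hg : MemLp g 2 Q)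
    {ε t : ℝ} (ht : 0 < t)
    (h : ∫ z, g z ^ 2 ∂Q ≤ ε) :
    (Measure.pi fun _ : ι => Q) {v | t ≤ |∑ i, (g (v i) - ∫ z, g z ∂Q)|} ≤
      ENNReal.ofReal (Fintype.card ι * ε / t ^ 2) := by
  have hLp : ∀ i : ι, MemLp (fun v : ι → 𝒵 => g (v i)) 2 (Measure.pi fun _ : ι => Q) := fun i =>
    hg.comp_measurePreserving (measurePreserving_eval (fun _ : ι => Q) i)
  have hS : MemLp (fun v : ι → 𝒵 => ∑ i, g (v i)) 2 (Measure.pi fun _ : ι => Q) :=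
    memLp_finsetSum _ fun i _ => hLp i
  have hmean : ∫ v : ι → 𝒵, ∑ i, g (v i) ∂(Measure.pi fun _ : ι => Q) =
      ∑ _i : ι, ∫ z, g z ∂Q := by
    rw [integral_finsetSum _ fun i _ => (hLp i).integrable one_le_two]
    exact Finset.sum_congr rfl fun i _ =>
      integral_comp_eval (μ := fun _ : ι => Q) hg.aestronglyMeasurable
  have hvar : variance (fun v : ι → 𝒵 => ∑ i, g (v i)) (Measure.pi fun _ : ι => Q) ≤
      Fintype.card ι * ε := by
    have := variance_sum_pi (μ := fun _ : ι => Q) (X := fun _ : ι => g) fun _ => hg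
    rw [Finset.sum_fn] at this
    rw [this]
    simp only [Finset.sum_const, Finset.card_univ, nsmul_eq_mul]
    have hv := variance_le_expectation_sq (μ := Q) (X := g) hg.aestronglyMeasurable
    simp only [Pi.pow_apply] at hv
    exact mul_le_mul_of_nonneg_left (hv.trans h) (Nat.cast_nonneg _)
  have hch := meas_ge_le_variance_div_sq hS ht
  rw [hmean] at hch
  simp only [Finset.sum_sub_distrib]
  refine hch.trans (ENNReal.ofReal_le_ofReal ?_)
  gcongr

/-- Chebyshev's inequality conditionally on an independent variable. -/
theorem measure_conditional_chebyshev [IsProbabilityMeasure Q] {W : Ω → 𝒲} {V : Ω → ι → 𝒵}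
    (hW : Measurable W)
    (hV : Measurable V)
    (hlaw : μ.map (fun ω => (W ω, V ω)) = (μ.map W).prod (Measure.pi fun _ => Q))
    {F : 𝒲 × 𝒵 → ℝ} (hF : Measurable F) {good : Set 𝒲} (hgood : MeasurableSet good)
    {ε t : ℝ} (hε : 0 ≤ ε) (ht : 0 < t)
    (h : ∀ w ∈ good, ∫⁻ z, ‖F (w, z)‖ₑ ^ 2 ∂Q ≤ ENNReal.ofReal ε) :
    μ {ω | W ω ∈ good ∧ t ≤ |∑ i, (F (W ω, V ω i) - ∫ z, F (W ω, z) ∂Q)|} ≤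
      ENNReal.ofReal (Fintype.card ι * ε / t ^ 2) * μ (W ⁻¹' good) := by
  have hint : Measurable fun w => ∫ z, F (w, z) ∂Q :=
    (hF.stronglyMeasurable.integral_prod_right' (ν := Q)).measurable
  have hsum : Measurable fun q : 𝒲 × (ι → 𝒵) =>
      |∑ i, (F (q.1, q.2 i) - ∫ z, F (q.1, z) ∂Q)| :=
    (Finset.measurable_fun_sum _ fun i _ => (hF.comp (measurable_fst.prodMk
      ((measurable_pi_apply i).comp measurable_snd))).sub (hint.comp measurable_fst)).abs
  let A : Set (𝒲 × (ι → 𝒵)) := {q | q.1 ∈ good ∧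
    t ≤ |∑ i, (F (q.1, q.2 i) - ∫ z, F (q.1, z) ∂Q)|}
  have hA : MeasurableSet A :=
    (measurable_fst hgood).inter (measurableSet_le measurable_const hsum)
  have hWV : Measurable fun ω => (W ω, V ω) := hW.prodMk hV
  have e1 : μ {ω | W ω ∈ good ∧ t ≤ |∑ i, (F (W ω, V ω i) - ∫ z, F (W ω, z) ∂Q)|} =
      ∫⁻ w, (Measure.pi fun _ : ι => Q) (Prod.mk w ⁻¹' A) ∂(μ.map W) := by
    rw [← Measure.prod_apply hA, ← hlaw, Measure.map_apply hWV hA]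
    rfl
  -- The bound is integrated over good values only. Keeping their probability as a factor lets
  -- bounds for different partitions add up without loss.
  rw [e1, ← Measure.map_apply hW hgood, ← lintegral_indicator_const hgood]
  refine lintegral_mono fun w => ?_
  by_cases hw : w ∈ good
  · rw [Set.indicator_of_mem hw]
    obtain ⟨h1, h2⟩ := memLp_two_of_lintegral_le (hF.comp measurable_prodMk_left) hε (h w hw)
    refine (measure_mono ?_).trans (measure_pi_abs_sum_sub_le h1 ht h2)
    exact fun v hv => hv.2
  · rw [Set.indicator_of_notMem hw]
    have : Prod.mk w ⁻¹' A = ∅ := by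
      ext v
      simp [A, hw]
    simp [this]

end ConditionalChebyshev

/-! ### Independence of a group from its training data -/

section JointLaw

variable {Ω 𝒰 𝒪 𝒵 : Type*} [MeasurableSpace Ω] [MeasurableSpace 𝒰] [MeasurableSpace 𝒪]
  [MeasurableSpace 𝒵] {μ : Measure Ω} [IsProbabilityMeasure μ] {Q : Measure 𝒵}
  {Z : ℕ → Ω → 𝒵} {U : Ω → 𝒰}

/-- Independence of three blocks regrouped through the associativity of product measures. -/
theorem IndepFun.prodMk_left_of_prodMk_right {α β γ : Type*} [MeasurableSpace α]
    [MeasurableSpace β] [MeasurableSpace γ] {X : Ω → α} {Y : Ω → β} {V : Ω → γ}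
    (hX : Measurable X) (hY : Measurable Y) (hV : Measurable V)
    (h : IndepFun X (fun ω => (Y ω, V ω)) μ) (h' : IndepFun Y V μ) :
    IndepFun (fun ω => (X ω, Y ω)) V μ := by
  have hXY : IndepFun X Y μ := h.comp measurable_id measurable_fst
  rw [indepFun_iff_map_prod_eq_prod_map_map hX.aemeasurable (hY.prodMk hV).aemeasurable,
    (indepFun_iff_map_prod_eq_prod_map_map hY.aemeasurable hV.aemeasurable).1 h',
    ← Measure.prodAssoc_prod,
    ← (indepFun_iff_map_prod_eq_prod_map_map hX.aemeasurable hY.aemeasurable).1 hXY] at h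
  rw [indepFun_iff_map_prod_eq_prod_map_map (hX.prodMk hY).aemeasurable hV.aemeasurable]
  refine MeasurableEquiv.prodAssoc.map_measurableEquiv_injective ?_
  rw [← h, Measure.map_map MeasurableEquiv.prodAssoc.measurable ((hX.prodMk hY).prodMk hV)]
  rfl

/-- The group `q` is deterministic here. Random partitions are handled later by summing over their
values. -/
theorem map_out_in_eq_prod (hZm : ∀ i, Measurable (Z i)) (hZlaw : ∀ i, μ.map (Z i) = Q)
    (hZ : iIndepFun Z μ) (hU : Measurable U) (hUZ : IndepFun U (fun ω i => Z i ω) μ)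
    {g : 𝒵 → 𝒪} (hg : Measurable g) {m : ℕ} (q : Fin m → Prop) [DecidablePred q] :
    μ.map (fun ω => ((U ω, fun i : {i // ¬ q i} => g (Z i.1 ω)), fun i : {i // q i} => Z i.1 ω)) =
      (μ.map fun ω => (U ω, fun i : {i // ¬ q i} => g (Z i.1 ω))).prod
        (Measure.pi fun _ => Q) := by
  have hZ' : iIndepFun (fun i : Fin m => Z i) μ := hZ.precomp Fin.val_injective
  have mout : Measurable fun ω => fun i : {i // ¬ q i} => g (Z i.1 ω) :=
    measurable_pi_iff.2 fun i => hg.comp (hZm _)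
  have min : Measurable fun ω => fun i : {i // q i} => Z i.1 ω :=
    measurable_pi_iff.2 fun i => hZm _
  have hio : IndepFun (fun ω => fun i : {i // ¬ q i} => g (Z i.1 ω))
      (fun ω => fun i : {i // q i} => Z i.1 ω) μ := by
    have hST : Disjoint (Finset.univ.filter fun i => ¬ q i) (Finset.univ.filter q) := by
      rw [disjoint_comm]
      exact Finset.disjoint_filter_filter_not _ _ _
    have := hZ'.indepFun_finset _ _ hST fun i => hZm i
    exact this.comp
      (φ := fun v : ({i // i ∈ Finset.univ.filter fun i : Fin m => ¬ q i} → 𝒵) =>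
        fun i : {i // ¬ q i} => g (v ⟨i.1, by simpa using i.2⟩))
      (ψ := fun v : ({i // i ∈ Finset.univ.filter q} → 𝒵) =>
        fun i : {i // q i} => v ⟨i.1, by simpa using i.2⟩)
      (measurable_pi_iff.2 fun i => hg.comp (measurable_pi_apply _))
      (measurable_pi_iff.2 fun i => measurable_pi_apply _)
  have hU' : IndepFun U (fun ω => ((fun i : {i // ¬ q i} => g (Z i.1 ω)),
      fun i : {i // q i} => Z i.1 ω)) μ :=
    hUZ.comp (ψ := fun v : ℕ → 𝒵 => ((fun i : {i // ¬ q i} => g (v i.1)),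
      fun i : {i // q i} => v i.1)) measurable_id
      ((measurable_pi_iff.2 fun i => hg.comp (measurable_pi_apply _)).prodMk
        (measurable_pi_iff.2 fun i => measurable_pi_apply _))
  have hind := IndepFun.prodMk_left_of_prodMk_right hU mout min hU' hio
  rw [(indepFun_iff_map_prod_eq_prod_map_map (hU.prodMk mout).aemeasurable min.aemeasurable).1 hind]
  congr 1
  have hin : iIndepFun (fun i : {i // q i} => Z i.1) μ := hZ'.precomp Subtype.val_injective
  rw [(iIndepFun_iff_map_fun_eq_pi_map fun i => (hZm _).aemeasurable).1 hin]
  simp [hZlaw]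

end JointLaw

/-! ### Group weights and the decomposition of the estimator -/

section Folds

variable {K m : ℕ}

/-- The weight `m / (K m_k)` of the clusters of group `k`, relative to equal weighting. -/
def foldRatio (s : Fin m → Fin K) (k : Fin K) : ℝ := m / (K * groupSize s k)

/-- The difference between the weighted summand at estimated nuisance functions and the summand at
the nuisance functions `η`. -/
def foldDiff (f : ∀ n : ℕ, PMF (Fin n → Bool)) (η : Nuisance p) (ρ : ℝ) (η' : Nuisance p)
    (z : AugObs p r) : ℝ :=
  ρ * approxIF f η' z - approxIF f η z

/-- The ratio is `1 / x` with `x = K m_k / m`. Once `x` is within `1/2` of one it is at least `1/2`,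
so inversion at most doubles the distance to one. -/
theorem foldRatio_bound {s : Fin m → Fin K} {k : Fin K} (hK : 0 < K) (hm : 0 < m) {B : ℝ}
    (h : |(groupSize s k : ℝ) / m - 1 / K| ≤ B / m) (hB : K * B / m ≤ 1 / 2) :
    0 < groupSize s k ∧ |foldRatio s k - 1| ≤ 2 * (K * B / m) := by
  have hK' : (0 : ℝ) < K := by positivity
  have hm' : (0 : ℝ) < m := by positivity
  set g : ℝ := (groupSize s k : ℝ) with hg
  set x : ℝ := (K : ℝ) * g / m with hx
  have hx1 : |x - 1| ≤ K * B / m := by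
    have : x - 1 = K * (g / m - 1 / K) := by
      rw [hx]
      field_simp
    rw [this, abs_mul, abs_of_pos hK', mul_div_assoc]
    exact mul_le_mul_of_nonneg_left h hK'.le
  have hx2 : 1 / 2 ≤ x := by
    have := (abs_le.1 hx1).1
    linarith
  have hgpos : 0 < g := by
    by_contra hcon
    have : g = 0 := le_antisymm (not_lt.1 hcon) (Nat.cast_nonneg _)
    rw [hx, this] at hx2
    norm_num at hx2
  refine ⟨Nat.cast_pos.1 hgpos, ?_⟩
  have hr : foldRatio s k - 1 = (1 - x) / x := by
    rw [foldRatio, hx, ← hg]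
    field_simp
  rw [hr, abs_div, abs_of_pos (by linarith : 0 < x), div_le_iff₀ (by linarith), abs_sub_comm]
  have h0 : 0 ≤ K * B / m := (abs_nonneg _).trans hx1
  nlinarith

theorem sum_groups_eq (s : Fin m → Fin K) (y : Fin m → ℝ) :
    ∑ k : Fin K, ∑ i ∈ Finset.univ.filter (fun i => s i = k), y i = ∑ i, y i :=
  Finset.sum_fiberwise _ _ _

theorem sum_groupSize (s : Fin m → Fin K) : ∑ k : Fin K, (groupSize s k : ℝ) = m := by
  have := sum_groups_eq s fun _ => (1 : ℝ)
  simpa [groupSize] using this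

/-- The centerings `b k` are arbitrary and cancel between the two sums. Taking them to be the means
at the fitted nuisance functions makes the first sum centered and the second the bias. -/
theorem sqrt_mul_weighted_sum_sub (hK : 0 < K) (hm : 0 < m) {s : Fin m → Fin K}
    (hs : ∀ k, 0 < groupSize s k) (x : Fin K → Fin m → ℝ) (y : Fin m → ℝ) (b : Fin K → ℝ) (Ψ : ℝ) :
    Real.sqrt m * ((1 / (K : ℝ)) * ∑ k, (1 / (groupSize s k : ℝ)) *
      ∑ i ∈ Finset.univ.filter (fun i => s i = k), x k i - Ψ) -
      (Real.sqrt m)⁻¹ * (∑ i, y i - m * Ψ) =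
    (∑ k, (Real.sqrt m)⁻¹ * ∑ i ∈ Finset.univ.filter (fun i => s i = k),
      ((foldRatio s k * x k i - y i) - (foldRatio s k * b k - Ψ))) +
    (1 / (K : ℝ)) * ∑ k, Real.sqrt m * (b k - Ψ) := by
  have hK' : (0 : ℝ) < K := by positivity
  have hm' : (0 : ℝ) < m := by positivity
  have hq : 0 < Real.sqrt m := Real.sqrt_pos.2 hm'
  have hqq : Real.sqrt m * Real.sqrt m = m := Real.mul_self_sqrt hm'.le
  have hsum : ∀ k, ∑ i ∈ Finset.univ.filter (fun i => s i = k),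
      ((foldRatio s k * x k i - y i) - (foldRatio s k * b k - Ψ)) =
      m * ((1 / (K : ℝ)) * ((1 / (groupSize s k : ℝ)) *
        ∑ i ∈ Finset.univ.filter (fun i => s i = k), x k i)) -
      ∑ i ∈ Finset.univ.filter (fun i => s i = k), y i - (m * ((1 / (K : ℝ)) * b k) -
        groupSize s k * Ψ) := by
    intro k
    have hg : (0 : ℝ) < groupSize s k := by exact_mod_cast hs k
    rw [Finset.sum_sub_distrib, Finset.sum_sub_distrib, ← Finset.mul_sum, Finset.sum_const,
      nsmul_eq_mul]
    change _ - _ - (groupSize s k : ℝ) * _ = _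
    rw [foldRatio]
    field_simp
  simp only [hsum]
  rw [← Finset.mul_sum, Finset.sum_sub_distrib, Finset.sum_sub_distrib, sum_groups_eq,
    Finset.sum_sub_distrib, ← Finset.sum_mul, sum_groupSize, ← Finset.mul_sum, ← Finset.mul_sum,
    ← Finset.mul_sum, ← Finset.mul_sum, ← Finset.mul_sum, Finset.sum_sub_distrib,
    Finset.sum_const, Finset.card_univ, Fintype.card_fin, nsmul_eq_mul]
  generalize Real.sqrt m = q at *
  rw [← hqq]
  field_simp
  ring

end Folds

/-! ### The centered sum over one group -/

section FoldChebyshev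

variable {Ω Ξ : Type*} [MeasurableSpace Ω] [MeasurableSpace Ξ] {μ : Measure Ω}
  [IsProbabilityMeasure μ] {K : ℕ} {P : Measure (Obs p)} [IsProbabilityMeasure P]
  {f : ∀ n : ℕ, PMF (Fin n → Bool)} {Z : ℕ → Ω → AugObs p r} {U : Ω → Ξ}
  {S : ∀ m : ℕ, Ξ → Fin m → Fin K} {L : Learner p K Ξ} {η : Nuisance p}

theorem Learner.IsMeasurable.isMeasurableFamily (hL : L.IsMeasurable) (m : ℕ) (k : Fin K)
    (s : Fin m → Fin K) : IsMeasurableFamily (L m k s) where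
  G := hL.G m k s
  H := hL.H m k s
  w := hL.w m k s
  phi := hL.phi m k s

/-- For each value `s` of the partition, conditional Chebyshev is applied on the event that the
partition equals `s`, which is part of `good s`. These events have total probability one, so the
number of partitions does not enter the bound. -/
theorem measure_fold_chebyshev (hZm : ∀ i, Measurable (Z i))
    (hZlaw : ∀ i, μ.map (Z i) = augLaw P f r) (hZindep : iIndepFun Z μ) (hU : Measurable U)
    (hUindep : IndepFun U (fun ω i => Z i ω) μ) (hS : ∀ m, Measurable (S m))
    (hL : L.IsMeasurable) (hη : η.IsMeasurable) (m : ℕ) (k : Fin K) {ε t : ℝ} (hε : 0 ≤ ε)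
    (ht : 0 < t) :
    μ {ω | ∫⁻ z, ‖foldDiff f η (foldRatio (S m (U ω)) k)
          (trained L k (S m (U ω)) (U ω) fun i => Z i ω) z‖ₑ ^ 2 ∂(augLaw P f r) ≤
            ENNReal.ofReal ε ∧
        t ≤ |∑ i ∈ Finset.univ.filter (fun i => S m (U ω) i = k),
          (foldDiff f η (foldRatio (S m (U ω)) k)
            (trained L k (S m (U ω)) (U ω) fun i => Z i ω) (Z i ω) -
          ∫ z, foldDiff f η (foldRatio (S m (U ω)) k)
            (trained L k (S m (U ω)) (U ω) fun i => Z i ω) z ∂(augLaw P f r))|} ≤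
      ENNReal.ofReal (m * ε / t ^ 2) := by
  let W : ∀ s : Fin m → Fin K, Ω → Ξ × ({i : Fin m // s i ≠ k} → Obs p) :=
    fun s ω => (U ω, fun i => (Z i.1 ω).obs)
  have hW : ∀ s, Measurable (W s) := fun s =>
    hU.prodMk (measurable_pi_iff.2 fun i => measurable_obs.comp (hZm _))
  let F : ∀ s : Fin m → Fin K,
      (Ξ × ({i : Fin m // s i ≠ k} → Obs p)) × AugObs p r → ℝ :=
    fun s q => foldDiff f η (foldRatio s k) (L m k s q.1) q.2
  have hF : ∀ s, Measurable (F s) := fun s =>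
    (((hL.isMeasurableFamily m k s).measurable_approxIF f).const_mul _).sub
      ((hη.measurable_approxIF f).comp measurable_snd)
  let good : ∀ s : Fin m → Fin K, Set (Ξ × ({i : Fin m // s i ≠ k} → Obs p)) := fun s =>
    {w | S m w.1 = s ∧ ∫⁻ z, ‖F s (w, z)‖ₑ ^ 2 ∂(augLaw P f r) ≤ ENNReal.ofReal ε}
  have hgood : ∀ s, MeasurableSet (good s) := fun s => by
    refine MeasurableSet.inter (((hS m).comp measurable_fst) (measurableSet_singleton s)) ?_
    exact measurableSet_le (((hF s).enorm.pow_const 2).lintegral_prod_right'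
      (ν := augLaw P f r)) measurable_const
  let A : (Fin m → Fin K) → Set Ω := fun s => {ω | W s ω ∈ good s ∧
    t ≤ |∑ i : {i // s i = k}, (F s (W s ω, Z i.1 ω) - ∫ z, F s (W s ω, z) ∂(augLaw P f r))|}
  have hA : ∀ s, μ (A s) ≤ ENNReal.ofReal (m * ε / t ^ 2) * μ ((fun ω => S m (U ω)) ⁻¹' {s}) := by
    intro s
    have hlaw := map_out_in_eq_prod hZm hZlaw hZindep hU hUindep measurable_obs
      (fun i : Fin m => s i = k)
    refine (measure_conditional_chebyshev (hW s)
      (measurable_pi_iff.2 fun i : {i // s i = k} => hZm i.1) hlaw (hF s) (hgood s) hε ht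
      fun w hw => hw.2).trans ?_
    refine mul_le_mul' (ENNReal.ofReal_le_ofReal ?_) (measure_mono fun ω hω => hω.1)
    gcongr
    have := Fintype.card_subtype_le fun i : Fin m => s i = k
    rwa [Fintype.card_fin] at this
  have hsub : {ω | ∫⁻ z, ‖foldDiff f η (foldRatio (S m (U ω)) k)
          (trained L k (S m (U ω)) (U ω) fun i => Z i ω) z‖ₑ ^ 2 ∂(augLaw P f r) ≤
            ENNReal.ofReal ε ∧
        t ≤ |∑ i ∈ Finset.univ.filter (fun i => S m (U ω) i = k),
          (foldDiff f η (foldRatio (S m (U ω)) k)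
            (trained L k (S m (U ω)) (U ω) fun i => Z i ω) (Z i ω) -
          ∫ z, foldDiff f η (foldRatio (S m (U ω)) k)
            (trained L k (S m (U ω)) (U ω) fun i => Z i ω) z ∂(augLaw P f r))|} ⊆
      ⋃ s, A s := by
    rintro ω ⟨h1, h2⟩
    refine Set.mem_iUnion.2 ⟨S m (U ω), ⟨rfl, h1⟩, ?_⟩
    rw [Finset.sum_subtype (p := fun i => S m (U ω) i = k) _ (by simp)] at h2
    exact h2
  calc _ ≤ μ (⋃ s, A s) := measure_mono hsub
    _ ≤ ∑ s, μ (A s) := measure_iUnion_fintype_le _ _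
    _ ≤ ∑ s, ENNReal.ofReal (m * ε / t ^ 2) * μ ((fun ω => S m (U ω)) ⁻¹' {s}) :=
      Finset.sum_le_sum fun s _ => hA s
    _ = ENNReal.ofReal (m * ε / t ^ 2) := by
      have h1 := sum_measure_preimage_singleton (μ := μ) (f := fun ω => S m (U ω)) Finset.univ
        fun s _ => ((hS m).comp hU) (measurableSet_singleton s)
      rw [← Finset.mul_sum, h1]
      simp

theorem isLittleOP_fold (hZm : ∀ i, Measurable (Z i))
    (hZlaw : ∀ i, μ.map (Z i) = augLaw P f r) (hZindep : iIndepFun Z μ) (hU : Measurable U)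
    (hUindep : IndepFun U (fun ω i => Z i ω) μ) (hS : ∀ m, Measurable (S m))
    (hL : L.IsMeasurable) (hη : η.IsMeasurable) (k : Fin K) {X : ℕ → Ω → ℝ}
    (hX : IsLittleOP μ X)
    (hle : ∀ᶠ m in atTop, ∀ᵐ ω ∂μ, ∫⁻ z, ‖foldDiff f η (foldRatio (S m (U ω)) k)
      (trained L k (S m (U ω)) (U ω) fun i => Z i ω) z‖ₑ ^ 2 ∂(augLaw P f r) ≤
        ENNReal.ofReal |X m ω|) :
    IsLittleOP μ fun m ω => (Real.sqrt m)⁻¹ *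
      ∑ i ∈ Finset.univ.filter (fun i => S m (U ω) i = k),
        (foldDiff f η (foldRatio (S m (U ω)) k)
          (trained L k (S m (U ω)) (U ω) fun i => Z i ω) (Z i ω) -
        ∫ z, foldDiff f η (foldRatio (S m (U ω)) k)
          (trained L k (S m (U ω)) (U ω) fun i => Z i ω) z ∂(augLaw P f r)) := by
  intro δ hδ
  refine tendsto_order.2 ⟨fun a ha => Eventually.of_forall fun m =>
    ha.trans_le measureReal_nonneg, fun a ha => ?_⟩
  -- Chosen so that Chebyshev at threshold `δ √m` gives `m ε / (δ √m)² = a / 2`; the event that the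
  -- `L₂` distance is too large takes the other half of `a`.
  set ε := δ ^ 2 * (a / 2) with hε
  have hε0 : 0 < ε := by positivity
  filter_upwards [hle, (tendsto_order.1 (hX ε hε0)).2 (a / 2) (half_pos ha),
    eventually_gt_atTop 0] with m h1 h2 hm
  have hm' : (0 : ℝ) < m := by exact_mod_cast hm
  have hq : 0 < Real.sqrt m := Real.sqrt_pos.2 hm'
  have hch := measure_fold_chebyshev hZm hZlaw hZindep hU hUindep hS hL hη m k hε0.le
    (mul_pos hδ hq)
  have heq : m * ε / (δ * Real.sqrt m) ^ 2 = a / 2 := by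
    rw [mul_pow, Real.sq_sqrt hm'.le, hε]
    field_simp
  rw [heq] at hch
  have hch' := ENNReal.toReal_mono ENNReal.ofReal_ne_top hch
  rw [ENNReal.toReal_ofReal (half_pos ha).le] at hch'
  refine lt_of_le_of_lt ?_ (add_lt_add_of_le_of_lt hch' h2 |>.trans_eq (add_halves a))
  refine le_trans ?_ (measureReal_union_le _ _)
  refine ENNReal.toReal_mono (measure_ne_top _ _) (measure_mono_ae ?_)
  filter_upwards [h1] with ω h3 h4
  by_cases hc : ε ≤ |X m ω|
  · exact Or.inr hc
  · refine Or.inl ⟨h3.trans (ENNReal.ofReal_le_ofReal (not_le.1 hc).le), ?_⟩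
    have h5 : δ ≤ |(Real.sqrt m)⁻¹ * _| := h4
    rw [abs_mul, abs_of_pos (inv_pos.2 hq), inv_mul_eq_div, le_div_iff₀ hq] at h5
    exact h5

/-- The training index set depends on the partition, but partitions take finitely many values, so
measurability can be checked with the partition frozen. -/
theorem measurable_appEstimator (hZm : ∀ i, Measurable (Z i)) (hU : Measurable U)
    (hS : ∀ m, Measurable (S m)) (hL : L.IsMeasurable) (m : ℕ) :
    Measurable fun ω => appEstimator f L (S m (U ω)) (U ω) fun i => Z i ω := by
  have h : Measurable fun q : (Fin m → Fin K) × Ω =>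
      appEstimator f L q.1 (U q.2) fun i => Z i q.2 := by
    refine measurable_from_prod_countable_right fun s => ?_
    have hk : ∀ (k : Fin K) (i : Fin m),
        Measurable fun ω => approxIF f (trained L k s (U ω) fun i => Z i ω) (Z i ω) := by
      intro k i
      have hW : Measurable fun ω =>
          ((U ω, fun j : {j : Fin m // s j ≠ k} => (Z j.1 ω).obs), Z i ω) :=
        (hU.prodMk (measurable_pi_iff.2 fun j => measurable_obs.comp (hZm _))).prodMk (hZm i)
      have := ((hL.isMeasurableFamily m k s).measurable_approxIF (r := r) f).comp hW
      exact this
    have hsum : Measurable fun ω => ∑ k : Fin K, (1 / (groupSize s k : ℝ)) *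
        ∑ i ∈ Finset.univ.filter (fun i : Fin m => s i = k),
          approxIF f (trained L k s (U ω) fun i => Z i ω) (Z i ω) :=
      Finset.measurable_fun_sum _ fun k _ =>
        (Finset.measurable_fun_sum _ fun i _ => hk k i).const_mul _
    have := hsum.const_mul (1 / (K : ℝ))
    exact this
  have h1 : Measurable fun ω => (S m (U ω), ω) := ((hS m).comp hU).prodMk measurable_id
  have := h.comp h1
  exact this

end FoldChebyshev

/-! ### Rates, bias and asymptotic linearity -/

section Remainder

variable {Ω Ξ : Type*} [MeasurableSpace Ω] [MeasurableSpace Ξ] {μ : Measure Ω}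
  [IsProbabilityMeasure μ] {K : ℕ} {P : Measure (Obs p)} [IsProbabilityMeasure P]
  {f : ∀ n : ℕ, PMF (Fin n → Bool)} {Z : ℕ → Ω → AugObs p r} {U : Ω → Ξ}
  {S : ∀ m : ℕ, Ξ → Fin m → Fin K} {L : Learner p K Ξ} {η : Nuisance p} {c C : ℝ} {N : ℕ}
  {rG rH rphi rw : ℕ → ℝ}

/-- The rates at which the estimated nuisance functions converge. -/
structure HasRates (μ : Measure Ω) (P : Measure (Obs p)) (η : Nuisance p)
    (η' : ℕ → Ω → Nuisance p) (rG rH rphi rw : ℕ → ℝ) : Prop where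
  H : IsBigOP μ (fun m ω => l2norm P (errH (η' m ω) η)) rH
  G : IsBigOP μ (fun m ω => l2norm P (errG (η' m ω) η)) rG
  phi : IsBigOP μ (fun m ω => l2norm P (errPhi (η' m ω) η)) rphi
  w : IsBigOP μ (fun m ω => l2norm P (errW (η' m ω) η)) fun m => rw m ^ 2

/-- The conditions on the rates. -/
structure AreFastRates (rG rH rphi rw : ℕ → ℝ) : Prop where
  G_pos : ∀ m, 0 < rG m
  H_pos : ∀ m, 0 < rH m
  phi_pos : ∀ m, 0 < rphi m
  G_tendsto : Tendsto rG atTop (𝓝 0)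
  H_tendsto : Tendsto rH atTop (𝓝 0)
  phi_tendsto : Tendsto rphi atTop (𝓝 0)
  w_tendsto : Tendsto (fun m : ℕ => Real.sqrt m * rw m ^ 2) atTop (𝓝 0)
  prod_tendsto : Tendsto (fun m : ℕ => Real.sqrt m * (rG m * (rH m + rphi m))) atTop (𝓝 0)

theorem AreFastRates.w_sq_tendsto (hr : AreFastRates rG rH rphi rw) :
    Tendsto (fun m => rw m ^ 2) atTop (𝓝 0) := by
  refine squeeze_zero' (Eventually.of_forall fun m => sq_nonneg _) ?_ hr.w_tendsto
  filter_upwards [eventually_ge_atTop 1] with m hm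
  have : (1 : ℝ) ≤ Real.sqrt m := Real.one_le_sqrt.2 (by exact_mod_cast hm)
  exact le_mul_of_one_le_left (sq_nonneg _) this

theorem areFastRates_of_isLittleO (hrG : ∀ m, 0 < rG m) (hrH : ∀ m, 0 < rH m)
    (hrphi : ∀ m, 0 < rphi m) (hG0 : rG =o[atTop] fun _ => (1 : ℝ))
    (hH0 : rH =o[atTop] fun _ => (1 : ℝ)) (hphi0 : rphi =o[atTop] fun _ => (1 : ℝ))
    (hw0 : rw =o[atTop] fun m : ℕ => (m : ℝ) ^ (-(1 / 4) : ℝ))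
    (hprod : (fun m => rG m * (rH m + rphi m)) =o[atTop] fun m : ℕ => (m : ℝ) ^ (-(1 / 2) : ℝ)) :
    AreFastRates rG rH rphi rw where
  G_pos := hrG
  H_pos := hrH
  phi_pos := hrphi
  G_tendsto := (isLittleO_one_iff ℝ).1 hG0
  H_tendsto := (isLittleO_one_iff ℝ).1 hH0
  phi_tendsto := (isLittleO_one_iff ℝ).1 hphi0
  w_tendsto := by
    have h := hw0.tendsto_div_nhds_zero.pow 2
    rw [zero_pow two_ne_zero] at h
    refine h.congr' ?_
    filter_upwards [eventually_gt_atTop 0] with m hm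
    have hm' : (0 : ℝ) < m := by exact_mod_cast hm
    rw [div_pow, ← Real.rpow_natCast ((m : ℝ) ^ (-(1 / 4) : ℝ)), ← Real.rpow_mul hm'.le,
      Real.sqrt_eq_rpow, div_eq_inv_mul, ← Real.rpow_neg hm'.le]
    norm_num
  prod_tendsto := by
    refine hprod.tendsto_div_nhds_zero.congr' ?_
    filter_upwards [eventually_gt_atTop 0] with m hm
    have hm' : (0 : ℝ) < m := by exact_mod_cast hm
    rw [Real.sqrt_eq_rpow, div_eq_inv_mul, ← Real.rpow_neg hm'.le]
    norm_num

/-- The bias of the estimated influence function is `o_ℙ(m^{-1/2})`. -/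
theorem isLittleOP_bias (h : IsRegularModel P η c C N) (hr : 0 < r) (hf : ∀ n a, 0 < f n a)
    {η' : ℕ → Ω → Nuisance p} (hη' : ∀ m, ∀ᵐ ω ∂μ, IsAdmissible P c C (η' m ω))
    (hrate : HasRates μ P η η' rG rH rphi rw) (hfast : AreFastRates rG rH rphi rw) :
    IsLittleOP μ fun m ω => Real.sqrt m *
      (∫ z : AugObs p r, approxIF f (η' m ω) z ∂(augLaw P f r) - estimand P η.w) := by
  have hsq : ∀ m : ℕ, 0 ≤ Real.sqrt m := fun m => Real.sqrt_nonneg _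
  have nG : ∀ m, 0 ≤ rG m := fun m => (hfast.G_pos m).le
  have nH : ∀ m, 0 ≤ rH m := fun m => (hfast.H_pos m).le
  have nP : ∀ m, 0 ≤ rphi m := fun m => (hfast.phi_pos m).le
  have nw : ∀ m, 0 ≤ rw m ^ 2 := fun m => sq_nonneg _
  have t1 : IsLittleOP μ fun m ω => Real.sqrt m * l2norm P (errW (η' m ω) η) :=
    hrate.w.isLittleOP nw hsq hfast.w_tendsto
  have t2 : IsLittleOP μ fun m ω => Real.sqrt m *
      (l2norm P (errH (η' m ω) η) * l2norm P (errG (η' m ω) η)) := by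
    refine (hrate.H.mul hrate.G nH nG).isLittleOP (fun m => mul_nonneg (nH m) (nG m)) hsq
      (squeeze_zero (fun m => mul_nonneg (hsq m) (mul_nonneg (nH m) (nG m))) (fun m => ?_)
        hfast.prod_tendsto)
    refine mul_le_mul_of_nonneg_left ?_ (hsq m)
    nlinarith [mul_nonneg (nG m) (nP m)]
  -- `r_w²` alone is already `o(m^{-1/2})`, and the factor `r_G` tends to zero.
  have t3 : IsLittleOP μ fun m ω => Real.sqrt m *
      (l2norm P (errW (η' m ω) η) * l2norm P (errG (η' m ω) η)) := by
    refine (hrate.w.mul hrate.G nw nG).isLittleOP (fun m => mul_nonneg (nw m) (nG m)) hsq ?_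
    simpa [mul_assoc] using hfast.w_tendsto.mul hfast.G_tendsto
  have t4 : IsLittleOP μ fun m ω => Real.sqrt m *
      (l2norm P (errPhi (η' m ω) η) * l2norm P (errG (η' m ω) η)) := by
    refine (hrate.phi.mul hrate.G nP nG).isLittleOP (fun m => mul_nonneg (nP m) (nG m)) hsq
      (squeeze_zero (fun m => mul_nonneg (hsq m) (mul_nonneg (nP m) (nG m))) (fun m => ?_)
        hfast.prod_tendsto)
    refine mul_le_mul_of_nonneg_left ?_ (hsq m)
    nlinarith [mul_nonneg (nG m) (nH m)]
  refine (((t1.const_mul C).add (t2.const_mul (C / c))).add (t3.add t4)).mono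
    (Eventually.of_forall fun m => ?_)
  filter_upwards [hη' m] with ω hω
  rw [h.integral_approxIF hr hf hω, abs_mul, abs_of_nonneg (hsq m)]
  refine le_trans (mul_le_mul_of_nonneg_left (h.abs_integral_uncenteredIF_sub_le hω) (hsq m))
    (le_trans (le_of_eq ?_) (le_abs_self _))
  ring

/-- The `L₂` distance between the summands at estimated and true nuisance functions vanishes. -/
theorem exists_isLittleOP_foldDiff_bound (h : IsRegularModel P η c C N)
    {η' : ℕ → Ω → Nuisance p} (hη' : ∀ m, ∀ᵐ ω ∂μ, IsAdmissible P c C (η' m ω))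
    (hrate : HasRates μ P η η' rG rH rphi rw) (hfast : AreFastRates rG rH rphi rw)
    {ρ : ℕ → Ω → ℝ} {e : ℕ → ℝ} (he : Tendsto e atTop (𝓝 0))
    (hρ : ∀ᶠ m in atTop, ∀ᵐ ω ∂μ, |ρ m ω - 1| ≤ e m) :
    ∃ X : ℕ → Ω → ℝ, IsLittleOP μ X ∧ ∀ᶠ m in atTop, ∀ᵐ ω ∂μ,
      ∫⁻ z : AugObs p r, ‖foldDiff f η (ρ m ω) (η' m ω) z‖ₑ ^ 2 ∂(augLaw P f r) ≤
        ENNReal.ofReal |X m ω| := by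
  obtain ⟨M, hM0, hM⟩ := h.integral_sq_approxIF_sub_le f r
  have o : ∀ {X : ℕ → Ω → ℝ} {τ : ℕ → ℝ}, IsBigOP μ X τ → (∀ m, 0 ≤ τ m) →
      Tendsto τ atTop (𝓝 0) → IsLittleOP μ X := by
    intro X τ hX hτ h0
    simpa using hX.isLittleOP hτ (ν := fun _ => 1) (fun _ => zero_le_one) (by simpa using h0)
  have oH := (o hrate.H (fun m => (hfast.H_pos m).le) hfast.H_tendsto).sq
  have oG := (o hrate.G (fun m => (hfast.G_pos m).le) hfast.G_tendsto).sq
  have oP := (o hrate.phi (fun m => (hfast.phi_pos m).le) hfast.phi_tendsto).sq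
  have ow := (o hrate.w (fun m => sq_nonneg _) hfast.w_sq_tendsto).sq
  set E : ℝ := ∫ z : AugObs p r, approxIF f η z ^ 2 ∂(augLaw P f r) with hE
  have he2 : Tendsto (fun m => 2 * e m ^ 2 * E) atTop (𝓝 0) := by
    simpa using ((he.pow 2).const_mul 2).mul_const E
  -- The witness follows from `ρ x - y = ρ (x - y) + (ρ - 1) y`: the square of a sum costs `2`, and
  -- `ρ² ≤ 4` as soon as `|ρ - 1| ≤ 1`, hence `8`. The second term is the cost of unequal group
  -- sizes.
  refine ⟨_, ((((oH.add oG).add oP).add ow).const_mul (8 * M)).add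
    (isLittleOP_of_tendsto he2), ?_⟩
  filter_upwards [hρ, (tendsto_order.1 he).2 1 zero_lt_one] with m h1 h2
  filter_upwards [h1, hη' m] with ω h3 h4
  have hL1 := h.memLp_approxIF (r := r) (f := f) h4
  have hL0 := h.memLp_approxIF (r := r) (f := f) h.toIsAdmissible
  have iD : Integrable (fun z : AugObs p r => (approxIF f (η' m ω) z - approxIF f η z) ^ 2)
      (augLaw P f r) := (hL1.sub hL0).integrable_sq
  have i0 : Integrable (fun z : AugObs p r => approxIF f η z ^ 2) (augLaw P f r) :=
    hL0.integrable_sq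
  have iF : Integrable (fun z : AugObs p r => foldDiff f η (ρ m ω) (η' m ω) z ^ 2)
      (augLaw P f r) := ((hL1.const_mul (ρ m ω)).sub hL0).integrable_sq
  have hρ2 : ρ m ω ^ 2 ≤ 4 := by
    have h5 := abs_le.1 (h3.trans h2.le)
    nlinarith [h5.1, h5.2]
  have he' : (ρ m ω - 1) ^ 2 ≤ e m ^ 2 := by
    rw [← sq_abs]
    exact pow_le_pow_left₀ (abs_nonneg _) h3 2
  have hint : ∫ z, foldDiff f η (ρ m ω) (η' m ω) z ^ 2 ∂(augLaw P f r) ≤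
      8 * ∫ z : AugObs p r, (approxIF f (η' m ω) z - approxIF f η z) ^ 2 ∂(augLaw P f r) +
        2 * e m ^ 2 * E := by
    rw [hE, ← integral_const_mul, ← integral_const_mul, ← integral_add (iD.const_mul _)
      (i0.const_mul _)]
    refine integral_mono iF ((iD.const_mul _).add (i0.const_mul _)) fun z => ?_
    simp only [foldDiff]
    set x := approxIF f (η' m ω) z
    set y := approxIF f η z
    have e1 : (ρ m ω * x - y) ^ 2 ≤
        2 * (ρ m ω ^ 2 * (x - y) ^ 2) + 2 * ((ρ m ω - 1) ^ 2 * y ^ 2) := by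
      nlinarith [sq_nonneg (ρ m ω * (x - y) - (ρ m ω - 1) * y)]
    have e2 : ρ m ω ^ 2 * (x - y) ^ 2 ≤ 4 * (x - y) ^ 2 :=
      mul_le_mul_of_nonneg_right hρ2 (sq_nonneg _)
    have e3 : (ρ m ω - 1) ^ 2 * y ^ 2 ≤ e m ^ 2 * y ^ 2 :=
      mul_le_mul_of_nonneg_right he' (sq_nonneg _)
    linarith
  have hlin : ∫⁻ z : AugObs p r, ‖foldDiff f η (ρ m ω) (η' m ω) z‖ₑ ^ 2 ∂(augLaw P f r) =
      ENNReal.ofReal (∫ z, foldDiff f η (ρ m ω) (η' m ω) z ^ 2 ∂(augLaw P f r)) := by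
    rw [ofReal_integral_eq_lintegral_ofReal iF (Eventually.of_forall fun z => sq_nonneg _)]
    refine lintegral_congr fun z => ?_
    rw [← enorm_pow, Real.enorm_eq_ofReal (sq_nonneg _)]
  rw [hlin]
  refine ENNReal.ofReal_le_ofReal (hint.trans (le_trans ?_ (le_abs_self _)))
  have := mul_le_mul_of_nonneg_left (hM _ h4) (by norm_num : (0 : ℝ) ≤ 8)
  linarith

/-- Asymptotic linearity of the estimator. -/
theorem isLittleOP_remainder (hr : 0 < r) (hK : 0 < K) (h : IsRegularModel P η c C N)
    (hf : ∀ n a, 0 < f n a) (hZm : ∀ i, Measurable (Z i))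
    (hZlaw : ∀ i, μ.map (Z i) = augLaw P f r) (hZindep : iIndepFun Z μ) (hU : Measurable U)
    (hUindep : IndepFun U (fun ω i => Z i ω) μ) (hS : ∀ m, Measurable (S m))
    (hSunif : ∃ B : ℝ, ∀ m : ℕ, 0 < m → ∀ k : Fin K, ∀ᵐ ω ∂μ,
      |(groupSize (S m (U ω)) k : ℝ) / m - 1 / K| ≤ B / m)
    (hL : L.IsMeasurable)
    (hadm : ∀ (m : ℕ) (k : Fin K), ∀ᵐ ω ∂μ,
      IsAdmissible P c C (trained L k (S m (U ω)) (U ω) fun i => Z i ω))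
    (hrate : ∀ k : Fin K, HasRates μ P η
      (fun m ω => trained L k (S m (U ω)) (U ω) fun i => Z i ω) rG rH rphi rw)
    (hfast : AreFastRates rG rH rphi rw) :
    IsLittleOP μ fun m ω => Real.sqrt m *
        (appEstimator f L (S m (U ω)) (U ω) (fun i => Z i ω) - estimand P η.w) -
      (Real.sqrt m)⁻¹ * (∑ i ∈ Finset.range m, approxIF f η (Z i ω) - m * estimand P η.w) := by
  obtain ⟨B, hB⟩ := hSunif
  set e : ℕ → ℝ := fun m => 2 * (K * B / m) with he
  have hKB : Tendsto (fun m : ℕ => K * B / (m : ℝ)) atTop (𝓝 0) :=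
    tendsto_const_div_atTop_nhds_zero_nat _
  have he0 : Tendsto e atTop (𝓝 0) := by simpa [he] using hKB.const_mul 2
  have hsize : ∀ᶠ m : ℕ in atTop, ∀ᵐ ω ∂μ, ∀ k : Fin K, 0 < groupSize (S m (U ω)) k ∧
      |foldRatio (S m (U ω)) k - 1| ≤ e m := by
    filter_upwards [eventually_gt_atTop 0, (tendsto_order.1 hKB).2 (1 / 2) (by norm_num)]
      with m hm h1
    filter_upwards [ae_all_iff.2 (hB m hm)] with ω hω k
    exact foldRatio_bound hK hm (hω k) h1.le
  have hfold : ∀ k : Fin K, IsLittleOP μ fun m ω => (Real.sqrt m)⁻¹ *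
      ∑ i ∈ Finset.univ.filter (fun i => S m (U ω) i = k),
        (foldDiff f η (foldRatio (S m (U ω)) k)
          (trained L k (S m (U ω)) (U ω) fun i => Z i ω) (Z i ω) -
        ∫ z, foldDiff f η (foldRatio (S m (U ω)) k)
          (trained L k (S m (U ω)) (U ω) fun i => Z i ω) z ∂(augLaw P f r)) := by
    intro k
    obtain ⟨X, hX, hle⟩ := exists_isLittleOP_foldDiff_bound (r := r) (f := f) h
      (fun m => hadm m k) (hrate k) hfast (ρ := fun m ω => foldRatio (S m (U ω)) k) he0
      (hsize.mono fun m hm => hm.mono fun ω hω => (hω k).2)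
    exact isLittleOP_fold hZm hZlaw hZindep hU hUindep hS hL h.meas k hX hle
  have hbias : ∀ k : Fin K, IsLittleOP μ fun m ω => Real.sqrt m *
      (∫ z, approxIF f (trained L k (S m (U ω)) (U ω) fun i => Z i ω) z ∂(augLaw P f r) -
        estimand P η.w) := fun k =>
    isLittleOP_bias h hr hf (fun m => hadm m k) (hrate k) hfast
  refine ((isLittleOP_sum Finset.univ fun k _ => hfold k).add
    ((isLittleOP_sum Finset.univ fun k _ => hbias k).const_mul (1 / (K : ℝ)))).mono ?_
  filter_upwards [hsize, eventually_gt_atTop 0] with m h1 hm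
  filter_upwards [h1, ae_all_iff.2 (hadm m)] with ω h2 h3
  refine le_of_eq (congrArg abs ?_)
  have hmean : ∫ z : AugObs p r, approxIF f η z ∂(augLaw P f r) = estimand P η.w := by
    rw [h.integral_approxIF hr hf h.toIsAdmissible, h.integral_uncenteredIF]
  have hdiff : ∀ k, ∫ z, foldDiff f η (foldRatio (S m (U ω)) k)
      (trained L k (S m (U ω)) (U ω) fun i => Z i ω) z ∂(augLaw P f r) =
      foldRatio (S m (U ω)) k *
        ∫ z, approxIF f (trained L k (S m (U ω)) (U ω) fun i => Z i ω) z ∂(augLaw P f r) -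
        estimand P η.w := by
    intro k
    have i1 := (h.memLp_approxIF (r := r) (f := f) (h3 k)).integrable one_le_two
    have i0 := (h.memLp_approxIF (r := r) (f := f) h.toIsAdmissible).integrable one_le_two
    have := integral_sub (i1.const_mul (foldRatio (S m (U ω)) k)) i0
    rw [integral_const_mul, hmean] at this
    exact this
  simp only [hdiff]
  rw [← Fin.sum_univ_eq_sum_range fun i => approxIF f η (Z i ω)]
  -- By `hdiff`, the omitted centerings are the means of `approxIF` at the fitted nuisance functions
  -- of each group.
  exact sqrt_mul_weighted_sum_sub hK hm (fun k => (h2 k).1)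
    (fun k i => approxIF f (trained L k (S m (U ω)) (U ω) fun i => Z i ω) (Z i ω))
    (fun i => approxIF f η (Z i ω)) _ _

end Remainder
end ClusterSubsampling

end

/-! ### Central limit theorem for the estimator -/

open ClusterSubsampling in
theorem mainTheorem10
    {Ω Ξ : Type*} [MeasurableSpace Ω] [MeasurableSpace Ξ] (μ : Measure Ω) [IsProbabilityMeasure μ]
    {p r K : ℕ} (hr : 0 < r) (hK : 0 < K)
    -- the law of one cluster, the weight functional and its influence function
    (P : Measure (Obs p)) [IsProbabilityMeasure P]
    (W : Measure (Obs p) → VecFun p) (phi : InflFun p)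
    (hW : ∀ n a, Measurable (W P n a))
    (hphi : ∀ n a' a, Measurable fun x => phi n a' x a)
    (heif : IsWeightEIF P W phi)
    -- the subsampling distribution on treatment vectors of each length
    (f : ∀ n : ℕ, PMF (Fin n → Bool)) (hf : ∀ n a, 0 < f n a)
    -- clusters with their random draws, independent and identically distributed
    (Z : ℕ → Ω → AugObs p r) (hZm : ∀ i, Measurable (Z i))
    (hZlaw : ∀ i, μ.map (Z i) = augLaw P f r)
    (hZindep : iIndepFun Z μ)
    -- auxiliary randomness of the split and of the nuisance estimators
    (U : Ω → Ξ) (hU : Measurable U) (hUindep : IndepFun U (fun ω i => Z i ω) μ)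
    -- random, approximately uniform partition into `K` groups
    (S : ∀ m : ℕ, Ξ → Fin m → Fin K) (hS : ∀ m, Measurable (S m))
    (hSunif : ∃ B : ℝ, ∀ m : ℕ, 0 < m → ∀ k : Fin K, ∀ᵐ ω ∂μ,
      |(groupSize (S m (U ω)) k : ℝ) / m - 1 / K| ≤ B / m)
    -- nuisance estimators trained on the other groups
    (L : Learner p K Ξ) (hL : L.IsMeasurable)
    (c C : ℝ) (hc : c ∈ Set.Ioo (0 : ℝ) 1) (hC : 0 < C)
    -- conditional moments of the outcomes, and bounded cluster sizes
    (hmom : ∀ j : ℕ, ∀ q ∈ Finset.Icc 1 4,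
      Integrable (fun o : Obs p => unitOutcome j o ^ q) P ∧
      ∀ᵐ o ∂P, |(P[fun o' : Obs p => unitOutcome j o' ^ q |
        MeasurableSpace.comap treatCov inferInstance]) o| ≤ C)
    (hsize : ∃ nmax : ℕ, ∀ᵐ o ∂P, o.1 ≤ nmax)
    -- boundedness of the nuisance functions and of their estimators
    (hbdd : ∀ᵐ o ∂P, (trueNuisance P W phi).BoundedAt c C o)
    (hbdd' : ∀ (m : ℕ) (k : Fin K), ∀ᵐ ω ∂μ, ∀ᵐ o ∂P,
      (trained L k (S m (U ω)) (U ω) (fun i => Z i ω)).BoundedAt c C o)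
    -- convergence rates of the nuisance estimators
    (rG rH rphi rw : ℕ → ℝ)
    (hrG : ∀ m, 0 < rG m) (hrH : ∀ m, 0 < rH m) (hrphi : ∀ m, 0 < rphi m) (hrw : ∀ m, 0 < rw m)
    (hrateH : ∀ k : Fin K, IsBigOP μ (fun m ω => l2norm P
      (errH (trained L k (S m (U ω)) (U ω) fun i => Z i ω) (trueNuisance P W phi))) rH)
    (hrateG : ∀ k : Fin K, IsBigOP μ (fun m ω => l2norm P
      (errG (trained L k (S m (U ω)) (U ω) fun i => Z i ω) (trueNuisance P W phi))) rG)
    (hratephi : ∀ k : Fin K, IsBigOP μ (fun m ω => l2norm P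
      (errPhi (trained L k (S m (U ω)) (U ω) fun i => Z i ω) (trueNuisance P W phi))) rphi)
    (hratew : ∀ k : Fin K, IsBigOP μ (fun m ω => l2norm P
      (errW (trained L k (S m (U ω)) (U ω) fun i => Z i ω) (trueNuisance P W phi)))
      fun m => rw m ^ 2)
    -- conditions on the rates
    (hG0 : rG =o[atTop] fun _ => (1 : ℝ)) (hH0 : rH =o[atTop] fun _ => (1 : ℝ))
    (hphi0 : rphi =o[atTop] fun _ => (1 : ℝ))
    (hw0 : rw =o[atTop] fun m : ℕ => (m : ℝ) ^ (-(1 / 4) : ℝ))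
    (hprod : (fun m => rG m * (rH m + rphi m)) =o[atTop] fun m : ℕ => (m : ℝ) ^ (-(1 / 2) : ℝ)) :
    TendstoInDistribution
      (fun (m : ℕ) (ω : Ω) => Real.sqrt m *
        (appEstimator f L (S m (U ω)) (U ω) (fun i => Z i ω) - estimand P (W P)))
      atTop (id : ℝ → ℝ) (fun _ => μ)
      (gaussianReal 0
        (Real.toNNReal (variance (approxIF f (trueNuisance P W phi)) (augLaw P f r)))) ∧
    variance (approxIF f (trueNuisance P W phi)) (augLaw P f r) =
      sigmaSq P W phi + (1 / (r : ℝ)) * meanCondVar P f (trueNuisance P W phi) := by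
  obtain ⟨N, hN⟩ := hsize
  set η := trueNuisance P W phi with hη
  have hmeas : η.IsMeasurable :=
    ⟨measurable_outcomeRegression P, measurable_treatmentProb P, hW, hphi⟩
  have hmod : IsRegularModel P η c C N :=
    { meas := hmeas
      bounded := hbdd
      G_eq := rfl
      H_eq := rfl
      c_pos := hc.1
      C_pos := hC
      size := hN
      integrable_outcome := fun j => by simpa using (hmom j 1 (by simp)).1
      integrable_outcome_sq := fun j => (hmom j 2 (by simp)).1
      moment := fun j => (hmom j 2 (by simp)).2
      centered := heif.centered }
  refine ⟨?_, hmod.variance_approxIF hr hf⟩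
  have hφm : Measurable (approxIF f η : AugObs p r → ℝ) := hmeas.measurable_approxIF f
  have hrem := isLittleOP_remainder hr hK hmod hf hZm hZlaw hZindep hU hUindep hS hSunif hL
    (fun m k => (hbdd' m k).mono fun ω hω =>
      ⟨(hL.isMeasurableFamily m k (S m (U ω))).isMeasurable _, hω⟩)
    (fun k => ⟨hrateH k, hrateG k, hratephi k, hratew k⟩)
    (areFastRates_of_isLittleO hrG hrH hrphi hG0 hH0 hphi0 hw0 hprod)
  have hvar : variance (fun ω => approxIF f η (Z 0 ω)) μ =
      variance (approxIF f η) (augLaw P f r) := by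
    rw [← hZlaw 0, variance_map (by rw [hZlaw]; exact hφm.aemeasurable) (hZm 0).aemeasurable]
    rfl
  have hmean : ∫ ω, approxIF f η (Z 0 ω) ∂μ = estimand P (W P) := by
    rw [← integral_map (hZm 0).aemeasurable hφm.aestronglyMeasurable, hZlaw,
      hmod.integral_approxIF hr hf hmod.toIsAdmissible, hmod.integral_uncenteredIF]
    rfl
  have hLp : MemLp (fun ω => approxIF f η (Z 0 ω)) 2 μ := by
    have := hmod.memLp_approxIF (r := r) (f := f) hmod.toIsAdmissible
    rw [← hZlaw 0] at this
    exact (memLp_map_measure_iff this.1 (hZm 0).aemeasurable).1 this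
  have hid (i : ℕ) : μ.map (fun ω => approxIF f η (Z i ω)) = (augLaw P f r).map (approxIF f η) := by
    rw [← hZlaw i, Measure.map_map hφm (hZm i)]
    rfl
  have hclt := tendstoInDistribution_inv_sqrt_mul_sum_sub
    (P := μ) (X := fun i ω => approxIF f η (Z i ω)) (Y := (id : ℝ → ℝ))
    (P' := gaussianReal 0 (variance (fun ω => approxIF f η (Z 0 ω)) μ).toNNReal)
    ⟨aemeasurable_id, Measure.map_id⟩ hLp (hZindep.comp _ fun _ => hφm)
    (fun i => ⟨(hφm.comp (hZm i)).aemeasurable, (hφm.comp (hZm 0)).aemeasurable,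
      (hid i).trans (hid 0).symm⟩)
  rw [hmean] at hclt
  simp only [hvar] at hclt
  -- Slutsky's lemma: the remainder tends to zero in probability, so the estimator inherits the
  -- limit of the normalized sum.
  refine tendstoInDistribution_of_tendstoInMeasure_sub _ _ hclt ?_ fun m =>
    (((measurable_appEstimator hZm hU hS hL m).sub_const _).const_mul _).aemeasurable
  rw [tendstoInMeasure_iff_measureReal_norm]
  intro δ hδ
  have h := hrem δ hδ
  rw [show η.w = W P from rfl] at h
  simpa using h
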